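/- Let $n>p\ge 1$ and let $X_1,\dots,X_n$ be i.i.d. $N_p(\theta,\Sigma)$ with $\theta\in\mathbb R^p$ and $\Sigma$ an unknown positive definite matrix. Let $\mathcal H^*_p=\{\theta\in\mathbb R^p:\theta_p\ge 0\}$, and let $\mathcal C\subseteq\mathcal H^*_p$ be a closed convex cone with nonempty interior. For $\mathcal K\in\{\mathcal C,\mathcal H^*_p\}$ consider testing $H_0:\theta=0$ against $H_1:\theta\in\mathcal K\setminus\{0\}$ and the likelihood ratio statistic $$\Lambda_{\mathcal K}=\frac{\sup_{\theta\in\mathcal K,\ \Sigma>0}\ \prod_{i=1}^n f_{\theta,\Sigma}(X_i)}{\sup_{\Sigma>0}\ \prod_{i=1}^n f_{0,\Sigma}(X_i)},$$ where $f_{\theta,\Sigma}$ is the $N_p(\theta,\Sigma)$ density. The likelihood ratio test (LRT) against $\mathcal K$ rejects $H_0$ if $\Lambda_{\mathcal K}\ge c$; its size is $\sup_{\Sigma>0}P_{0,\Sigma}(\Lambda_{\mathcal K}\ge c)$. Then the LRT against $\mathcal C\setminus\{0\}$ is dominated by the LRT against $\mathcal H^*_p\setminus\{0\}$: 1. for every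 critical value $c$, $\ \sup_{\Sigma>0}P_{0,\Sigma}(\Lambda_{\mathcal C}\ge c)=\sup_{\Sigma>0}P_{0,\Sigma}(\Lambda_{\mathcal H^*_p}\ge c)$; 2. if $0<\alpha<1$ and $c,d$ are critical values such that the tests $\Lambda_{\mathcal C}\ge c$ and $\Lambda_{\mathcal H^*_p}\ge d$ both have size $\alpha$, then $P_{\theta,\Sigma}(\Lambda_{\mathcal C}\ge c)\le P_{\theta,\Sigma}(\Lambda_{\mathcal H^*_p}\ge d)$ for all $\theta\in\mathbb R^p$ and all positive definite $\Sigma$; 3. if moreover $\mathcal C\ne\mathcal H^*_p$, then the inequality in 2 is strict for some $\theta\in\mathcal C\setminus\{0\}$ and some positive definite $\Sigma$. The same three assertions hold with $\Lambda_{\mathcal K}$ replaced by the statistic $$L_{\mathcal K}=\frac{\|\pi_{\mathcal K}\|_{S}^2}{1+\|\sqrt n\,\bar X-\pi_{\mathcal K}\|_{S}^2},$$ where $\bar X=n^{-1}\sum_i X_i$, $S=(n-1)^{-1}\sum_i (X_i-\bar X)(X_i-\bar X)'$, $\|x\|_{S}^2=x'S^{-1}x$, and $\pi_{\mathcal K}$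 is the projection of $\sqrt n\,\bar X$ onto $\mathcal K$ in the norm $\|\cdot\|_S$. -/

import Mathlib

open MeasureTheory ProbabilityTheory
open scoped ENNReal

noncomputable section

/-- A sample of `n` observations in `ℝ^p`. -/
abbrev Sample (n p : ℕ) : Type := Fin n → EuclideanSpace ℝ (Fin p)

/-- The law of `n` independent `N_p(θ, V)` observations. -/
def sampleLaw (n : ℕ) {p : ℕ} (θ : EuclideanSpace ℝ (Fin p)) (V : Matrix (Fin p) (Fin p) ℝ) :
    Measure (Sample n p) :=
  Measure.pi fun _ => multivariateGaussian θ V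

/-- The halfspace of all `θ` whose last coordinate is nonnegative. -/
def lastHalfspace (p : ℕ) [NeZero p] : Set (EuclideanSpace ℝ (Fin p)) :=
  {θ | 0 ≤ θ ⟨p - 1, Nat.pred_lt (NeZero.ne p)⟩}

/-- The squared norm `‖x‖_A² = x' A⁻¹ x`. -/
def sqNorm {p : ℕ} (A : Matrix (Fin p) (Fin p) ℝ) (x : EuclideanSpace ℝ (Fin p)) : ℝ :=
  x.ofLp ⬝ᵥ (A⁻¹.mulVec x.ofLp)

/-! ### The likelihood ratio -/

/-- The joint density of `n` independent `N_p(θ, V)` observations (for positive definite `V`). -/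
def likelihood {n p : ℕ} (X : Sample n p) (θ : EuclideanSpace ℝ (Fin p))
    (V : Matrix (Fin p) (Fin p) ℝ) : ℝ :=
  ∏ i, (Real.sqrt ((2 * Real.pi) ^ p * V.det))⁻¹ * Real.exp (-(sqNorm V (X i - θ)) / 2)

/-- The supremum of the likelihood over `θ ∈ K` and over all positive definite dispersion
matrices. -/
def supLikelihood {n p : ℕ} (K : Set (EuclideanSpace ℝ (Fin p))) (X : Sample n p) : ℝ≥0∞ :=
  ⨆ θ ∈ K, ⨆ (V : Matrix (Fin p) (Fin p) ℝ) (_ : V.PosDef), ENNReal.ofReal (likelihood X θ V)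

/-- The likelihood ratio statistic for `θ = 0` against `θ ∈ K \ {0}`, with the dispersion matrix
an unknown nuisance parameter (`K` contains `0`, so it is the union of both hypotheses). -/
def likelihoodRatio {n p : ℕ} (K : Set (EuclideanSpace ℝ (Fin p))) (X : Sample n p) : ℝ≥0∞ :=
  supLikelihood K X / supLikelihood {0} X

/-! ### The projection form of the statistic -/

/-- The sample mean. -/
def sampleMean {n p : ℕ} (X : Sample n p) : EuclideanSpace ℝ (Fin p) :=
  (n : ℝ)⁻¹ • ∑ i, X i

/-- The sample covariance matrix, with divisor `n - 1`. -/
def sampleCov {n p : ℕ} (X : Sample n p) : Matrix (Fin p) (Fin p) ℝ :=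
  ((n : ℝ) - 1)⁻¹ •
    ∑ i, Matrix.vecMulVec (X i - sampleMean X).ofLp (X i - sampleMean X).ofLp

open Classical in
/-- The projection of `x` onto `K` with respect to the norm `‖·‖_A`: a point of `K` nearest to `x`
(it exists and is unique if `K` is nonempty, closed and convex and `A` is positive definite;
the value is `0` if there is no nearest point). -/
def coneProj {p : ℕ} (A : Matrix (Fin p) (Fin p) ℝ) (K : Set (EuclideanSpace ℝ (Fin p)))
    (x : EuclideanSpace ℝ (Fin p)) : EuclideanSpace ℝ (Fin p) :=
  if h : ∃ y ∈ K, ∀ z ∈ K, sqNorm A (x - y) ≤ sqNorm A (x - z) then h.choose else 0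

/-- The statistic `‖π‖_S² / (1 + ‖√n X̄ - π‖_S²)`, where `S` is the sample covariance matrix and
`π` is the projection of `√n X̄` onto `K` with respect to `‖·‖_S`. -/
def projStat {n p : ℕ} (K : Set (EuclideanSpace ℝ (Fin p))) (X : Sample n p) : ℝ :=
  let y := Real.sqrt n • sampleMean X
  let π := coneProj (sampleCov X) K y
  sqNorm (sampleCov X) π / (1 + sqNorm (sampleCov X) (y - π))

/-! ### Power, size and domination -/

/-- The power function of the test with critical region `W`: its rejection probability at
`(θ, V)`. -/
def power {n p : ℕ} (W : Set (Sample n p)) (θ : EuclideanSpace ℝ (Fin p))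
    (V : Matrix (Fin p) (Fin p) ℝ) : ℝ≥0∞ :=
  sampleLaw n θ V W

/-- The size of the test with critical region `W` for `θ = 0`: the supremum of its rejection
probability under the null hypothesis over all positive definite dispersion matrices. -/
def testSize {n p : ℕ} (W : Set (Sample n p)) : ℝ≥0∞ :=
  ⨆ (V : Matrix (Fin p) (Fin p) ℝ) (_ : V.PosDef), power W 0 V

/-- The critical region `T ≥ c`. -/
def critRegion {n p : ℕ} {β : Type*} [LE β] (T : Sample n p → β) (c : β) : Set (Sample n p) :=
  {X | c ≤ T X}

/-- The test that rejects for large values of `stat K` is dominated by the test that rejects for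
large values of `stat H`, where `stat K` and `stat H` are the statistics for testing `θ = 0`
against `K \ {0}` and against `H \ {0}`. -/
structure TestDominated {n p : ℕ} {β : Type*} [LE β]
    (stat : Set (EuclideanSpace ℝ (Fin p)) → Sample n p → β)
    (K H : Set (EuclideanSpace ℝ (Fin p))) : Prop where
  /-- With the same critical value, the two tests have the same size. -/
  size_eq : ∀ c : β, testSize (critRegion (stat K) c) = testSize (critRegion (stat H) c)
  /-- At every level, the power of the first test nowhere exceeds the power of the second. -/
  power_le : ∀ α : ℝ≥0∞, 0 < α → α < 1 → ∀ c d : β,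
    testSize (critRegion (stat K) c) = α → testSize (critRegion (stat H) d) = α →
    ∀ (θ : EuclideanSpace ℝ (Fin p)) (V : Matrix (Fin p) (Fin p) ℝ), V.PosDef →
      power (critRegion (stat K) c) θ V ≤ power (critRegion (stat H) d) θ V
  /-- Unless `K = H`, at every level the inequality is strict at some alternative. -/
  power_lt : K ≠ H → ∀ α : ℝ≥0∞, 0 < α → α < 1 → ∀ c d : β,
    testSize (critRegion (stat K) c) = α → testSize (critRegion (stat H) d) = α →
    ∃ θ ∈ K \ {0}, ∃ V : Matrix (Fin p) (Fin p) ℝ, V.PosDef ∧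
      power (critRegion (stat K) c) θ V < power (critRegion (stat H) d) θ V

end

/-! ### The quadratic form `sqNorm` -/

/-! Write `t` for the squared length of `√n X̄` and `d` for its squared distance to the cone `K`,
both in the norm of `S`. Since `n > p`, `S` is almost surely positive definite
(`ae_posDef_sampleCov`). Then Pythagoras for the nearest point in a cone gives `L_K = (t - d) / (1 +
d)`, and maximizing over the dispersion matrix gives `Λ_K = ((n - 1 + t) / (n - 1 + d)) ^ (n / 2)`.
So, apart from the trivial critical values, both tests reject on `meanRegion k a K`, that is `(t -
d) / (k + d) ≥ a`, with `k = 1` or `k = n - 1` and with `a > 0` depending on the critical value but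
not on `K`.

A smaller cone has a larger `d`, so the region of `C` lies in that of the halfspace `H` for the same
`a`. What remains is that the two sizes agree. Replacing the null dispersion `1` by `G Gᵀ` amounts
to replacing `K` by `G⁻¹ K`. For `H` one can factor any `V` as `G Gᵀ` with `G⁻¹ H = H`, so the null
rejection probability is constant. For `C`, let `G` contract towards the line through an interior
point of `C`: then `G⁻¹ C` eventually contains each point of the open halfspace, and the rejection
probabilities approach that of `H` (`power_coordHalfspace_le_testSize`).

Tests of equal level therefore have, up to null sets, the same `a`, and inclusion of regions gives
the power inequality. It is strict because the difference of the regions has positive volume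
(`volume_meanRegion_diff_ne_zero`) and nondegenerate Gaussian samples have the same null sets as
Lebesgue measure. -/

open scoped MatrixOrder in
lemma Matrix.PosDef.sqrt_mul_sqrt {p : ℕ} {A : Matrix (Fin p) (Fin p) ℝ} (hA : A.PosDef) :
    CFC.sqrt A * CFC.sqrt A = A :=
  CFC.sqrt_mul_sqrt_self A hA.posSemidef.nonneg

open scoped MatrixOrder in
lemma Matrix.transpose_sqrt {p : ℕ} (A : Matrix (Fin p) (Fin p) ℝ) :
    (CFC.sqrt A).transpose = CFC.sqrt A := by
  have : (CFC.sqrt A).conjTranspose = CFC.sqrt A := (CFC.sqrt_nonneg A).isSelfAdjoint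
  rwa [Matrix.conjTranspose_eq_transpose_of_trivial] at this

open scoped MatrixOrder in
lemma Matrix.PosDef.isUnit_det_sqrt {p : ℕ} {A : Matrix (Fin p) (Fin p) ℝ} (hA : A.PosDef) :
    IsUnit (CFC.sqrt A).det := by
  have h := congrArg Matrix.det hA.sqrt_mul_sqrt
  rw [Matrix.det_mul] at h
  exact isUnit_iff_ne_zero.2 (left_ne_zero_of_mul (h.trans_ne hA.det_pos.ne'))

/-- The continuous linear equivalence given by an invertible matrix. -/
noncomputable def Matrix.toEuclideanCLE {p : ℕ} {G : Matrix (Fin p) (Fin p) ℝ}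
    (hG : IsUnit G.det) : EuclideanSpace ℝ (Fin p) ≃L[ℝ] EuclideanSpace ℝ (Fin p) :=
  ContinuousLinearEquiv.equivOfInverse (Matrix.toEuclideanCLM (𝕜 := ℝ) G)
    (Matrix.toEuclideanCLM (𝕜 := ℝ) G⁻¹)
    (fun x => by
      rw [← mul_apply_eq_comp, ← map_mul, Matrix.nonsing_inv_mul G hG, map_one,
        one_apply_eq_self])
    (fun x => by
      rw [← mul_apply_eq_comp, ← map_mul, Matrix.mul_nonsing_inv G hG, map_one,
        one_apply_eq_self])

lemma Matrix.ofLp_toEuclideanCLM_apply {p : ℕ} (G : Matrix (Fin p) (Fin p) ℝ)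
    (x : EuclideanSpace ℝ (Fin p)) :
    (Matrix.toEuclideanCLM (𝕜 := ℝ) G x).ofLp = G.mulVec x.ofLp :=
  Matrix.ofLp_toEuclideanCLM G x

section SqNorm

variable {p : ℕ} {A : Matrix (Fin p) (Fin p) ℝ}

lemma sqNorm_nonneg (hA : A.PosSemidef) (x : EuclideanSpace ℝ (Fin p)) : 0 ≤ sqNorm A x := by
  simpa [sqNorm] using hA.inv.dotProduct_mulVec_nonneg x.ofLp

lemma sqNorm_pos (hA : A.PosDef) {x : EuclideanSpace ℝ (Fin p)} (hx : x ≠ 0) :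
    0 < sqNorm A x := by
  simpa [sqNorm] using hA.inv.dotProduct_mulVec_pos (x := x.ofLp) (by simpa using hx)

lemma sqNorm_zero (A : Matrix (Fin p) (Fin p) ℝ) : sqNorm A 0 = 0 := by simp [sqNorm]

lemma sqNorm_smul (A : Matrix (Fin p) (Fin p) ℝ) (c : ℝ) (x : EuclideanSpace ℝ (Fin p)) :
    sqNorm A (c • x) = c ^ 2 * sqNorm A x := by
  simp only [sqNorm, WithLp.ofLp_smul, Matrix.mulVec_smul, smul_dotProduct, dotProduct_smul,
    smul_eq_mul]
  ring

lemma sqNorm_smul_matrix (c : ℝ) (A : Matrix (Fin p) (Fin p) ℝ)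
    (hA : IsUnit A.det) (x : EuclideanSpace ℝ (Fin p)) :
    sqNorm (c • A) x = c⁻¹ * sqNorm A x := by
  rcases eq_or_ne c 0 with rfl | hc
  · simp [sqNorm]
  · have : (c • A)⁻¹ = c⁻¹ • A⁻¹ := Matrix.inv_smul' A (Units.mk0 c hc) hA
    simp [sqNorm, this, Matrix.smul_mulVec, dotProduct_smul]

lemma continuous_sqNorm (A : Matrix (Fin p) (Fin p) ℝ) : Continuous (sqNorm A) := by
  unfold sqNorm
  fun_prop

lemma sqNorm_conj {G : Matrix (Fin p) (Fin p) ℝ} (hG : IsUnit G.det)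
    (A : Matrix (Fin p) (Fin p) ℝ) (x : EuclideanSpace ℝ (Fin p)) :
    sqNorm (G * A * G.transpose) (Matrix.toEuclideanCLM (𝕜 := ℝ) G x) = sqNorm A x := by
  have h1 : G⁻¹ * G = 1 := Matrix.nonsing_inv_mul G hG
  have h2 : G.transpose * (G.transpose)⁻¹ = 1 :=
    Matrix.mul_nonsing_inv _ (by rwa [Matrix.det_transpose])
  simp only [sqNorm, Matrix.ofLp_toEuclideanCLM_apply, Matrix.mul_inv_rev]
  rw [Matrix.mulVec_mulVec, Matrix.mul_assoc, Matrix.mul_assoc, h1, Matrix.mul_one]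
  rw [← Matrix.vecMul_transpose, ← Matrix.dotProduct_mulVec, Matrix.mulVec_mulVec,
    ← Matrix.mul_assoc, h2, Matrix.one_mul]

-- The map `A^(-1/2)` turns `‖·‖_A` into the Euclidean norm, which makes inner products and metric
-- projections available.
open scoped MatrixOrder in
lemma sqNorm_eq_norm_sq (hA : A.PosDef) (x : EuclideanSpace ℝ (Fin p)) :
    sqNorm A x = ‖Matrix.toEuclideanCLE hA.inv.isUnit_det_sqrt x‖ ^ 2 := by
  change _ = ‖Matrix.toEuclideanCLM (𝕜 := ℝ) (CFC.sqrt A⁻¹) x‖ ^ 2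
  rw [EuclideanSpace.real_norm_sq_eq]
  simp only [Matrix.ofLp_toEuclideanCLM_apply, sq]
  change _ = (CFC.sqrt A⁻¹).mulVec x.ofLp ⬝ᵥ (CFC.sqrt A⁻¹).mulVec x.ofLp
  rw [Matrix.dotProduct_mulVec, ← Matrix.mulVec_transpose, Matrix.mulVec_mulVec,
    Matrix.transpose_sqrt, hA.inv.sqrt_mul_sqrt, dotProduct_comm, sqNorm]

end SqNorm

/-! ### Sample mean and sample covariance -/

section SampleMoments

variable {n p : ℕ}

lemma continuous_sampleMean : Continuous (sampleMean : Sample n p → _) := by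
  unfold sampleMean
  fun_prop

lemma continuous_sampleCov : Continuous (sampleCov : Sample n p → _) := by
  have := continuous_sampleMean (n := n) (p := p)
  refine continuous_matrix fun j k => ?_
  simp only [sampleCov, Matrix.smul_apply, Matrix.sum_apply, Matrix.vecMulVec_apply]
  fun_prop

lemma sampleMean_map (L : EuclideanSpace ℝ (Fin p) →L[ℝ] EuclideanSpace ℝ (Fin p))
    (X : Sample n p) : sampleMean (fun i => L (X i)) = L (sampleMean X) := by
  simp [sampleMean]

lemma sampleCov_map (G : Matrix (Fin p) (Fin p) ℝ) (X : Sample n p) :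
    sampleCov (fun i => Matrix.toEuclideanCLM (𝕜 := ℝ) G (X i)) =
      G * sampleCov X * G.transpose := by
  simp only [sampleCov, sampleMean_map, ← map_sub, Matrix.ofLp_toEuclideanCLM_apply,
    Matrix.mul_smul, Matrix.smul_mul, Matrix.mul_sum, Matrix.sum_mul, Matrix.mul_vecMulVec,
    Matrix.vecMulVec_mul, Matrix.vecMul_transpose]

lemma posSemidef_sampleCov (hn : 1 ≤ n) (X : Sample n p) : (sampleCov X).PosSemidef := by
  refine Matrix.PosSemidef.smul (Matrix.posSemidef_sum _ fun i _ => ?_) ?_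
  · simpa using Matrix.posSemidef_vecMulVec_self_star (R := ℝ) (X i - sampleMean X).ofLp
  · have : (1 : ℝ) ≤ n := by exact_mod_cast hn
    exact inv_nonneg.2 (by linarith)

lemma dotProduct_sampleCov_mulVec (X : Sample n p) (u : Fin p → ℝ) :
    u ⬝ᵥ (sampleCov X).mulVec u =
      ((n : ℝ) - 1)⁻¹ * ∑ i, (u ⬝ᵥ (X i - sampleMean X).ofLp) ^ 2 := by
  simp only [sampleCov, Matrix.smul_mulVec, dotProduct_smul, smul_eq_mul, Matrix.sum_mulVec,
    dotProduct_sum, Matrix.vecMulVec_mulVec]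
  congr 1
  refine Finset.sum_congr rfl fun i _ => ?_
  rw [dotProduct_comm _ u, op_smul_eq_smul, smul_eq_mul, sq]

/-- The sample obtained by multiplying the mean of `X` by `l` and keeping the residuals. -/
noncomputable def rescaleMean (l : ℝ) (X : Sample n p) : Sample n p :=
  fun i => X i + (l - 1) • sampleMean X

lemma sampleMean_rescaleMean (hn : n ≠ 0) (l : ℝ) (X : Sample n p) :
    sampleMean (rescaleMean l X) = l • sampleMean X := by
  have h : (n : ℝ) ≠ 0 := by exact_mod_cast hn
  have : ∑ i, rescaleMean l X i = ∑ i, X i + ((n : ℝ) * (l - 1)) • sampleMean X := by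
    simp [rescaleMean, Finset.sum_add_distrib, ← Nat.cast_smul_eq_nsmul ℝ, smul_smul]
  rw [sampleMean, this, smul_add, ← sampleMean, smul_smul, ← mul_assoc, inv_mul_cancel₀ h, one_mul]
  module

lemma sampleCov_rescaleMean (hn : n ≠ 0) (l : ℝ) (X : Sample n p) :
    sampleCov (rescaleMean l X) = sampleCov X := by
  have h : ∀ i, rescaleMean l X i - l • sampleMean X = X i - sampleMean X := fun i => by
    simp only [rescaleMean]; module
  simp only [sampleCov, sampleMean_rescaleMean hn, h]

lemma rescaleMean_rescaleMean (hn : n ≠ 0) (l m : ℝ) (X : Sample n p) :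
    rescaleMean l (rescaleMean m X) = rescaleMean (l * m) X := by
  funext i
  simp only [rescaleMean.eq_1 l, sampleMean_rescaleMean hn]
  simp only [rescaleMean]
  module

lemma rescaleMean_one (X : Sample n p) : rescaleMean 1 X = X := by
  funext i; simp [rescaleMean]

lemma continuous_rescaleMean (l : ℝ) : Continuous (rescaleMean (n := n) (p := p) l) := by
  have := continuous_sampleMean (n := n) (p := p)
  unfold rescaleMean
  fun_prop

/-- `rescaleMean l` as a linear map. -/
noncomputable def rescaleMeanLinear (n p : ℕ) (l : ℝ) : Sample n p →ₗ[ℝ] Sample n p where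
  toFun := rescaleMean l
  map_add' X Y := by
    funext i
    simp only [rescaleMean, sampleMean, Pi.add_apply, Finset.sum_add_distrib]
    module
  map_smul' c X := by
    funext i
    simp only [rescaleMean, sampleMean, Pi.smul_apply, ← Finset.smul_sum, RingHom.id_apply]
    module

lemma quasiMeasurePreserving_rescaleMean (hn : n ≠ 0) {l : ℝ} (hl : l ≠ 0) :
    Measure.QuasiMeasurePreserving (rescaleMean (n := n) (p := p) l) volume volume := by
  refine Measure.LinearMap.quasiMeasurePreserving volume (rescaleMeanLinear n p l) ?_
  have h : rescaleMeanLinear n p l * rescaleMeanLinear n p l⁻¹ = 1 := by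
    refine LinearMap.ext fun X => ?_
    change rescaleMean l (rescaleMean l⁻¹ X) = X
    rw [rescaleMean_rescaleMean hn, mul_inv_cancel₀ hl, rescaleMean_one]
  have := congrArg LinearMap.det h
  rw [map_mul, map_one] at this
  exact left_ne_zero_of_mul_eq_one this

end SampleMoments

/-! ### The sample covariance is almost surely positive definite -/

section PosDef

variable {n p : ℕ}

lemma exists_posDef_sampleCov (hnp : p < n) : ∃ Z : Sample n p, (sampleCov Z).PosDef := by
  classical
  -- The standard basis vectors followed by zeros. As `p < n`, the zero vector occurs at index `p`,
  -- so a vector `u` with constant products `u ⬝ᵥ Z i` must vanish.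
  let Z : Sample n p := fun i =>
    if h : (i : ℕ) < p then EuclideanSpace.single (⟨i, h⟩ : Fin p) (1 : ℝ) else 0
  have hS := posSemidef_sampleCov (by omega) Z
  refine ⟨Z, Matrix.PosDef.of_dotProduct_mulVec_pos hS.isHermitian fun u hu => ?_⟩
  refine lt_of_le_of_ne (hS.dotProduct_mulVec_nonneg u) fun h0 => hu ?_
  rcases Nat.eq_zero_or_pos p with hp | hp
  · subst hp; exact Subsingleton.elim _ _
  have hn1 : ((n : ℝ) - 1)⁻¹ ≠ 0 := by
    have : (2 : ℝ) ≤ n := by exact_mod_cast (by omega : 2 ≤ n)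
    exact inv_ne_zero (by linarith)
  rw [star_trivial, dotProduct_sampleCov_mulVec, eq_comm, mul_eq_zero, or_iff_right hn1,
    Finset.sum_eq_zero_iff_of_nonneg fun i _ => sq_nonneg _] at h0
  have h1 : ∀ i, u ⬝ᵥ (Z i).ofLp = u ⬝ᵥ (sampleMean Z).ofLp := fun i => by
    have := h0 i (Finset.mem_univ i)
    rw [sq_eq_zero_iff, WithLp.ofLp_sub, dotProduct_sub, sub_eq_zero] at this
    exact this
  funext j
  have h2 := (h1 ⟨j, j.2.trans hnp⟩).trans (h1 ⟨p, hnp⟩).symm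
  simpa [Z] using h2

lemma sampleCov_add_smul_apply (Z X : Sample n p) (m : ℝ) (j k : Fin p) :
    sampleCov (Z + m • X) j k = ((n : ℝ) - 1)⁻¹ * ∑ i,
      ((Z i - sampleMean Z) j + m * (X i - sampleMean X) j) *
        ((Z i - sampleMean Z) k + m * (X i - sampleMean X) k) := by
  have hmean : sampleMean (Z + m • X) = sampleMean Z + m • sampleMean X := by
    simp only [sampleMean, Pi.add_apply, Pi.smul_apply, Finset.sum_add_distrib,
      ← Finset.smul_sum]
    module
  simp only [sampleCov, Matrix.smul_apply, Matrix.sum_apply, Matrix.vecMulVec_apply, hmean,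
    smul_eq_mul]
  congr 1
  refine Finset.sum_congr rfl fun i _ => ?_
  simp only [Pi.add_apply, Pi.smul_apply, PiLp.sub_apply, PiLp.add_apply, PiLp.smul_apply,
    smul_eq_mul]
  ring

-- Along the line `m ↦ Z + m • X` the determinant is a polynomial in `m`, and it does not vanish at
-- `m = 0`.
open Polynomial in
lemma finite_setOf_det_sampleCov_eq_zero {Z : Sample n p} (hZ : (sampleCov Z).det ≠ 0)
    (X : Sample n p) : {m : ℝ | (sampleCov (Z + m • X)).det = 0}.Finite := by
  let M : Matrix (Fin p) (Fin p) ℝ[X] := Matrix.of fun j k => C ((n : ℝ) - 1)⁻¹ * ∑ i,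
      (C ((Z i - sampleMean Z) j) + Polynomial.X * C ((X i - sampleMean X) j)) *
        (C ((Z i - sampleMean Z) k) + Polynomial.X * C ((X i - sampleMean X) k))
  have hM : ∀ m, M.det.eval m = (sampleCov (Z + m • X)).det := fun m => by
    rw [← Polynomial.coe_evalRingHom, RingHom.map_det]
    congr 1
    ext j k
    rw [sampleCov_add_smul_apply]
    simp [M, eval_finsetSum]
  have h0 : M.det ≠ 0 := fun h => hZ (by simpa [h] using (hM 0).symm)
  refine (M.det.rootSet_finite ℝ).subset fun m hm => ?_
  rw [Polynomial.mem_rootSet]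
  exact ⟨h0, by simpa [hM m] using hm⟩

/-- For every `X` only finitely many `m` make the covariance of `Z + m • X` singular. By Fubini some
`m ≠ 0` is good for almost every `X`, and `X ↦ Z + m • X` is an affine bijection that respects null
sets in both directions. -/
lemma ae_posDef_sampleCov (hnp : p < n) :
    ∀ᵐ X : Sample n p, (sampleCov X).PosDef := by
  obtain ⟨Z, hZ⟩ := exists_posDef_sampleCov hnp
  have hmeas : MeasurableSet
      {x : Sample n p × ℝ | (sampleCov (Z + x.2 • x.1)).det ≠ 0} := by
    refine (isOpen_ne_fun ?_ continuous_const).measurableSet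
    exact (continuous_sampleCov.comp (by fun_prop)).matrix_det
  have h1 : ∀ᵐ X : Sample n p, ∀ᵐ m : ℝ, (sampleCov (Z + m • X)).det ≠ 0 :=
    Filter.Eventually.of_forall fun X =>
      ((finite_setOf_det_sampleCov_eq_zero hZ.det_pos.ne' X).countable.ae_notMem volume)
  have h2 := (Measure.ae_ae_comm hmeas).1 h1
  obtain ⟨m, hm, hm0⟩ := (h2.and (Measure.ae_ne volume (0 : ℝ))).exists
  have hq : Measure.QuasiMeasurePreserving (fun X : Sample n p => m⁻¹ • (-Z + X))
      volume volume :=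
    (Measure.quasiMeasurePreserving_smul volume (inv_ne_zero hm0)).comp
      (measurePreserving_add_left volume (-Z)).quasiMeasurePreserving
  filter_upwards [hq.ae hm] with X hX
  rw [smul_smul, mul_inv_cancel₀ hm0, one_smul, add_neg_cancel_left] at hX
  exact (posSemidef_sampleCov (by omega) X).posDef_iff_det_ne_zero.2 hX

end PosDef

/-! ### The distance of the standardized mean from a set -/

section DistSq

variable {n p : ℕ}

/-- The vector `√n X̄`. -/
noncomputable def scaledMean (X : Sample n p) : EuclideanSpace ℝ (Fin p) :=
  Real.sqrt n • sampleMean X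

/-- The squared distance from `√n X̄` to `K`, in the norm `‖·‖_S` of the sample covariance. -/
noncomputable def meanDistSq (K : Set (EuclideanSpace ℝ (Fin p))) (X : Sample n p) : ℝ :=
  ⨅ z : K, sqNorm (sampleCov X) (scaledMean X - z)

/-- The squared length of `√n X̄`, in the norm `‖·‖_S` of the sample covariance. -/
noncomputable def meanLengthSq (X : Sample n p) : ℝ :=
  sqNorm (sampleCov X) (scaledMean X)

lemma scaledMean_map (L : EuclideanSpace ℝ (Fin p) →L[ℝ] EuclideanSpace ℝ (Fin p))
    (X : Sample n p) : scaledMean (fun i => L (X i)) = L (scaledMean X) := by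
  simp [scaledMean, sampleMean_map]

lemma scaledMean_rescaleMean (hn : n ≠ 0) (l : ℝ) (X : Sample n p) :
    scaledMean (rescaleMean l X) = l • scaledMean X := by
  simp only [scaledMean, sampleMean_rescaleMean hn, smul_comm l]

lemma continuous_scaledMean : Continuous (scaledMean : Sample n p → _) :=
  continuous_sampleMean.const_smul (Real.sqrt n)

lemma measurable_sqNorm_sampleCov {f : Sample n p → EuclideanSpace ℝ (Fin p)}
    (hf : Continuous f) : Measurable fun X => sqNorm (sampleCov X) (f X) := by
  -- This holds for singular matrices too, where both inverses are `0` by convention, so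
  -- measurability needs no exceptional set.
  have h : ∀ X, sqNorm (sampleCov X) (f X) = ((sampleCov X).det)⁻¹ *
      ((f X).ofLp ⬝ᵥ ((sampleCov X).adjugate.mulVec (f X).ofLp)) := fun X => by
    simp [sqNorm, Matrix.inv_def, Matrix.smul_mulVec, dotProduct_smul]
  simp only [h]
  have hS := continuous_sampleCov (n := n) (p := p)
  refine hS.matrix_det.measurable.inv.mul (Continuous.measurable ?_)
  have hf' : Continuous fun X => (f X).ofLp := by fun_prop
  exact hf'.dotProduct (hS.matrix_adjugate.matrix_mulVec hf')

lemma bddBelow_range_sqNorm (hn : 1 ≤ n) (K : Set (EuclideanSpace ℝ (Fin p)))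
    (X : Sample n p) :
    BddBelow (Set.range fun z : K => sqNorm (sampleCov X) (scaledMean X - z)) :=
  ⟨0, by rintro _ ⟨z, rfl⟩; exact sqNorm_nonneg (posSemidef_sampleCov hn X) _⟩

lemma meanDistSq_nonneg (hn : 1 ≤ n) (K : Set (EuclideanSpace ℝ (Fin p))) (X : Sample n p) :
    0 ≤ meanDistSq K X :=
  Real.iInf_nonneg fun _ => sqNorm_nonneg (posSemidef_sampleCov hn X) _

lemma meanDistSq_le (hn : 1 ≤ n) {K : Set (EuclideanSpace ℝ (Fin p))} (X : Sample n p)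
    {z : EuclideanSpace ℝ (Fin p)} (hz : z ∈ K) :
    meanDistSq K X ≤ sqNorm (sampleCov X) (scaledMean X - z) :=
  ciInf_le (bddBelow_range_sqNorm hn K X) ⟨z, hz⟩

lemma meanDistSq_anti (hn : 1 ≤ n) {K H : Set (EuclideanSpace ℝ (Fin p))} (hK : K.Nonempty)
    (hKH : K ⊆ H) (X : Sample n p) : meanDistSq H X ≤ meanDistSq K X := by
  have := hK.to_subtype
  exact le_ciInf fun z => meanDistSq_le hn X (hKH z.2)

lemma meanDistSq_le_meanLengthSq (hn : 1 ≤ n) {K : Set (EuclideanSpace ℝ (Fin p))}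
    (h0 : (0 : EuclideanSpace ℝ (Fin p)) ∈ K) (X : Sample n p) :
    meanDistSq K X ≤ meanLengthSq X := by
  simpa [meanLengthSq] using meanDistSq_le hn X h0

lemma measurable_meanLengthSq : Measurable (meanLengthSq : Sample n p → ℝ) :=
  measurable_sqNorm_sampleCov continuous_scaledMean

/-- By continuity of the quadratic form, the infimum may be taken over a countable dense subset of
`K`. -/
lemma measurable_meanDistSq (hn : 1 ≤ n) {K : Set (EuclideanSpace ℝ (Fin p))}
    (hK : K.Nonempty) : Measurable (meanDistSq K : Sample n p → ℝ) := by
  have := hK.to_subtype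
  have h : ∀ X : Sample n p, meanDistSq K X =
      ⨅ i, sqNorm (sampleCov X) (scaledMean X - TopologicalSpace.denseSeq K i) := fun X => by
    refine le_antisymm (le_ciInf fun i => meanDistSq_le hn X (Subtype.coe_prop _))
      (le_ciInf fun z => ?_)
    refine (TopologicalSpace.denseRange_denseSeq K).induction_on z
      (p := fun z : K => _ ≤ sqNorm (sampleCov X) (scaledMean X - z)) ?_ fun i => ?_
    · exact isClosed_le continuous_const ((continuous_sqNorm _).comp (by fun_prop))
    · refine ciInf_le ?_ i
      exact ⟨0, by rintro _ ⟨z, rfl⟩; exact sqNorm_nonneg (posSemidef_sampleCov hn X) _⟩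
  simp only [funext h]
  exact Measurable.iInf fun i =>
    measurable_sqNorm_sampleCov (continuous_scaledMean.sub continuous_const)

lemma meanLengthSq_map {G : Matrix (Fin p) (Fin p) ℝ} (hG : IsUnit G.det) (X : Sample n p) :
    meanLengthSq (fun i => Matrix.toEuclideanCLM (𝕜 := ℝ) G (X i)) = meanLengthSq X := by
  rw [meanLengthSq, scaledMean_map, sampleCov_map, sqNorm_conj hG, meanLengthSq]

/-- The norm of `S` moves along with the data, so a linear change of the data is equivalent to the
inverse change of the cone. -/
lemma meanDistSq_map {G : Matrix (Fin p) (Fin p) ℝ} (hG : IsUnit G.det)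
    (K : Set (EuclideanSpace ℝ (Fin p))) (X : Sample n p) :
    meanDistSq K (fun i => Matrix.toEuclideanCLM (𝕜 := ℝ) G (X i)) =
      meanDistSq (Matrix.toEuclideanCLM (𝕜 := ℝ) G ⁻¹' K) X := by
  set L := Matrix.toEuclideanCLM (𝕜 := ℝ) G with hL
  have hsurj : Function.Surjective L := (Matrix.toEuclideanCLE hG).surjective
  have hs : Function.Surjective (fun z : L ⁻¹' K => (⟨L z, z.2⟩ : K)) := by
    rintro ⟨w, hw⟩
    obtain ⟨z, rfl⟩ := hsurj w
    exact ⟨⟨z, hw⟩, rfl⟩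
  rw [meanDistSq, ← hs.iInf_comp, meanDistSq]
  refine iInf_congr fun z => ?_
  rw [scaledMean_map, sampleCov_map, ← map_sub, sqNorm_conj hG]

lemma meanLengthSq_rescaleMean (hn : n ≠ 0) (l : ℝ) (X : Sample n p) :
    meanLengthSq (rescaleMean l X) = l ^ 2 * meanLengthSq X := by
  rw [meanLengthSq, scaledMean_rescaleMean hn, sampleCov_rescaleMean hn, sqNorm_smul,
    meanLengthSq]

/-- A nonempty closed set that is stable under multiplication with nonnegative numbers. -/
structure IsClosedCone {E : Type*} [TopologicalSpace E] [AddCommGroup E] [Module ℝ E]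
    (K : Set E) : Prop where
  isClosed : IsClosed K
  zero_mem : (0 : E) ∈ K
  smul_mem : ∀ c : ℝ, 0 ≤ c → ∀ z ∈ K, c • z ∈ K

/-- Distance and length are both homogeneous of degree two in the mean, whereas the term `a * k` in
`meanRegion` is constant. Moving along these rays thus crosses the boundary of the region. -/
lemma meanDistSq_rescaleMean (hn : n ≠ 0) {l : ℝ} (hl : 0 < l)
    {K : Set (EuclideanSpace ℝ (Fin p))} (hK : IsClosedCone K) (X : Sample n p) :
    meanDistSq K (rescaleMean l X) = l ^ 2 * meanDistSq K X := by
  have hs : Function.Surjective (fun z : K => (⟨l • (z : EuclideanSpace ℝ (Fin p)),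
      hK.smul_mem l hl.le z z.2⟩ : K)) := by
    rintro ⟨w, hw⟩
    refine ⟨⟨l⁻¹ • w, hK.smul_mem _ (inv_nonneg.2 hl.le) w hw⟩, ?_⟩
    simp [smul_smul, mul_inv_cancel₀ hl.ne']
  rw [meanDistSq, ← hs.iInf_comp, meanDistSq, Real.mul_iInf_of_nonneg (sq_nonneg l)]
  refine iInf_congr fun z => ?_
  rw [scaledMean_rescaleMean hn, sampleCov_rescaleMean hn, ← smul_sub, sqNorm_smul]

-- After the transformation to the Euclidean norm this is the existence of a nearest point in a
-- nonempty closed subset of a proper space.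
open scoped MatrixOrder in
lemma exists_sqNorm_eq_meanDistSq {K : Set (EuclideanSpace ℝ (Fin p))}
    (hK : IsClosed K) (hne : K.Nonempty) {X : Sample n p} (hX : (sampleCov X).PosDef) :
    ∃ z ∈ K, (∀ w ∈ K, sqNorm (sampleCov X) (scaledMean X - z) ≤
      sqNorm (sampleCov X) (scaledMean X - w)) ∧
      meanDistSq K X = sqNorm (sampleCov X) (scaledMean X - z) := by
  have hL := sqNorm_eq_norm_sq hX
  set L := Matrix.toEuclideanCLE hX.inv.isUnit_det_sqrt
  have hcl : IsClosed (L '' K) := L.toHomeomorph.isClosedMap K hK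
  obtain ⟨_, ⟨z, hz, rfl⟩, hd⟩ := hcl.exists_infDist_eq_dist (hne.image L) (L (scaledMean X))
  have hmin : ∀ w ∈ K, sqNorm (sampleCov X) (scaledMean X - z) ≤
      sqNorm (sampleCov X) (scaledMean X - w) := fun w hw => by
    rw [hL, hL, map_sub, map_sub, ← dist_eq_norm, ← dist_eq_norm, ← hd]
    exact pow_le_pow_left₀ Metric.infDist_nonneg
      (Metric.infDist_le_dist_of_mem (Set.mem_image_of_mem L hw)) 2
  refine ⟨z, hz, hmin, ?_⟩
  have := hne.to_subtype
  refine le_antisymm (ciInf_le ⟨sqNorm (sampleCov X) (scaledMean X - z), ?_⟩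
    (⟨z, hz⟩ : K)) (le_ciInf fun w => hmin w w.2)
  rintro _ ⟨w, rfl⟩
  exact hmin w w.2

end DistSq

/-! ### Absolute continuity of Gaussian samples -/

lemma MeasureTheory.Measure.AbsolutelyContinuous.pi_fin {α : Type*} [MeasurableSpace α] :
    ∀ {n : ℕ} {μ ν : Fin n → Measure α} [∀ i, SigmaFinite (μ i)] [∀ i, SigmaFinite (ν i)],
      (∀ i, μ i ≪ ν i) → Measure.pi μ ≪ Measure.pi ν
  | 0, μ, ν, _, _, _ => by
    rw [Measure.pi_of_empty μ Fin.elim0, Measure.pi_of_empty ν Fin.elim0]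
  | n + 1, μ, ν, _, _, h => by
    let e := MeasurableEquiv.piFinSuccAbove (fun _ : Fin (n + 1) => α) 0
    have hμ := (measurePreserving_piFinSuccAbove μ 0).symm e
    have hν := (measurePreserving_piFinSuccAbove ν 0).symm e
    rw [← hμ.map_eq, ← hν.map_eq]
    exact ((h 0).prod (pi_fin fun j => h _)).map e.symm.measurable

section Gaussian

variable {p : ℕ}

lemma stdGaussian_absolutelyContinuous :
    stdGaussian (EuclideanSpace ℝ (Fin p)) ≪ volume := by
  rw [← map_pi_eq_stdGaussian, ← (PiLp.volume_preserving_toLp (Fin p)).map_eq]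
  exact (Measure.AbsolutelyContinuous.pi_fin fun _ =>
    gaussianReal_absolutelyContinuous 0 one_ne_zero).map (PiLp.volume_preserving_toLp _).measurable

lemma volume_absolutelyContinuous_stdGaussian :
    volume ≪ stdGaussian (EuclideanSpace ℝ (Fin p)) := by
  rw [← map_pi_eq_stdGaussian, ← (PiLp.volume_preserving_toLp (Fin p)).map_eq]
  exact (Measure.AbsolutelyContinuous.pi_fin fun _ =>
    gaussianReal_absolutelyContinuous' 0 one_ne_zero).map (PiLp.volume_preserving_toLp _).measurable

lemma quasiMeasurePreserving_toEuclideanCLM {G : Matrix (Fin p) (Fin p) ℝ} (hG : IsUnit G.det)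
    (θ : EuclideanSpace ℝ (Fin p)) :
    Measure.QuasiMeasurePreserving (fun x => θ + Matrix.toEuclideanCLM (𝕜 := ℝ) G x)
      volume volume := by
  refine (measurePreserving_add_left volume θ).quasiMeasurePreserving.comp
    (Measure.LinearMap.quasiMeasurePreserving volume
      (Matrix.toEuclideanCLE hG).toLinearEquiv.toLinearMap ?_)
  exact (LinearEquiv.isUnit_det' _).ne_zero

variable {V : Matrix (Fin p) (Fin p) ℝ}

lemma multivariateGaussian_absolutelyContinuous (hV : V.PosDef)
    (θ : EuclideanSpace ℝ (Fin p)) : multivariateGaussian θ V ≪ volume := by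
  have hq := quasiMeasurePreserving_toEuclideanCLM hV.isUnit_det_sqrt θ
  exact (stdGaussian_absolutelyContinuous.map hq.measurable).trans hq.absolutelyContinuous

open scoped MatrixOrder in
lemma volume_absolutelyContinuous_multivariateGaussian (hV : V.PosDef)
    (θ : EuclideanSpace ℝ (Fin p)) : volume ≪ multivariateGaussian θ V := by
  have hq := quasiMeasurePreserving_toEuclideanCLM hV.isUnit_det_sqrt θ
  refine Measure.AbsolutelyContinuous.trans ?_
    (volume_absolutelyContinuous_stdGaussian.map hq.measurable)
  -- The inverse affine map: pushing `volume` through it and back shows that `volume` is absolutely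
  -- continuous with respect to its own image.
  have hr : Measure.QuasiMeasurePreserving
      (fun x => Matrix.toEuclideanCLM (𝕜 := ℝ) (CFC.sqrt V)⁻¹ (-θ + x)) volume volume := by
    have h := quasiMeasurePreserving_toEuclideanCLM
      (Matrix.isUnit_nonsing_inv_det _ hV.isUnit_det_sqrt) 0
    simp only [zero_add] at h
    exact h.comp (measurePreserving_add_left volume (-θ)).quasiMeasurePreserving
  have h := hr.absolutelyContinuous.map hq.measurable
  rwa [Measure.map_map hq.measurable hr.measurable, show _ ∘ _ = id from ?_, Measure.map_id] at h
  funext x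
  have := (Matrix.toEuclideanCLE hV.isUnit_det_sqrt).apply_symm_apply (-θ + x)
  change θ + Matrix.toEuclideanCLE hV.isUnit_det_sqrt
    ((Matrix.toEuclideanCLE hV.isUnit_det_sqrt).symm (-θ + x)) = x
  rw [this, add_neg_cancel_left]

variable {n : ℕ}

lemma sampleLaw_absolutelyContinuous (hV : V.PosDef) (θ : EuclideanSpace ℝ (Fin p)) :
    sampleLaw n θ V ≪ volume :=
  Measure.AbsolutelyContinuous.pi_fin fun _ => multivariateGaussian_absolutelyContinuous hV θ

lemma volume_absolutelyContinuous_sampleLaw (hV : V.PosDef) (θ : EuclideanSpace ℝ (Fin p)) :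
    volume ≪ sampleLaw n θ V :=
  Measure.AbsolutelyContinuous.pi_fin fun _ =>
    volume_absolutelyContinuous_multivariateGaussian hV θ

instance isProbabilityMeasure_sampleLaw (θ : EuclideanSpace ℝ (Fin p)) :
    IsProbabilityMeasure (sampleLaw n θ V) := by
  unfold sampleLaw
  infer_instance

/-! ### Linear images of standard Gaussian samples -/

/-- Compare characteristic functions, moving `G` to its transpose on the other side of the inner
product. -/
lemma map_toEuclideanCLM_stdGaussian (G : Matrix (Fin p) (Fin p) ℝ) :
    (stdGaussian (EuclideanSpace ℝ (Fin p))).map (Matrix.toEuclideanCLM (𝕜 := ℝ) G) =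
      multivariateGaussian 0 (G * G.transpose) := by
  have hGG : (G * G.transpose).PosSemidef := by
    simpa [Matrix.conjTranspose_eq_transpose_of_trivial] using
      Matrix.posSemidef_self_mul_conjTranspose G
  have := Measure.isProbabilityMeasure_map (μ := stdGaussian (EuclideanSpace ℝ (Fin p)))
    (Matrix.toEuclideanCLM (𝕜 := ℝ) G).measurable.aemeasurable
  refine Measure.ext_of_charFun (funext fun t => ?_)
  have hinner : ∀ x, inner ℝ (Matrix.toEuclideanCLM (𝕜 := ℝ) G x) t =
      inner ℝ x (Matrix.toEuclideanCLM (𝕜 := ℝ) G.transpose t) := fun x => by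
    rw [Matrix.inner_toEuclideanCLM, real_inner_comm, Matrix.inner_toEuclideanCLM,
      Matrix.mulVec_transpose, Matrix.dotProduct_mulVec, dotProduct_comm]
  rw [charFun_multivariateGaussian hGG, charFun_apply, integral_map (by fun_prop) (by fun_prop)]
  simp only [hinner]
  rw [← charFun_apply, charFun_stdGaussian]
  congr 1
  rw [inner_zero_right, ← Complex.ofReal_pow, EuclideanSpace.real_norm_sq_eq]
  simp only [Matrix.ofLp_toEuclideanCLM_apply, sq]
  have : ∑ i, G.transpose.mulVec t.ofLp i * G.transpose.mulVec t.ofLp i =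
      t.ofLp ⬝ᵥ (G * G.transpose).mulVec t.ofLp := by
    change G.transpose.mulVec t.ofLp ⬝ᵥ G.transpose.mulVec t.ofLp = _
    rw [← Matrix.mulVec_mulVec, Matrix.dotProduct_mulVec t.ofLp G, Matrix.mulVec_transpose]
  rw [this]
  push_cast
  ring

lemma map_toEuclideanCLM_sampleLaw (G : Matrix (Fin p) (Fin p) ℝ) :
    (sampleLaw n 0 (1 : Matrix (Fin p) (Fin p) ℝ)).map
      (fun X i => Matrix.toEuclideanCLM (𝕜 := ℝ) G (X i)) = sampleLaw n 0 (G * G.transpose) := by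
  have h := map_toEuclideanCLM_stdGaussian G
  rw [← multivariateGaussian_zero_one] at h
  unfold sampleLaw
  have hs : SigmaFinite ((multivariateGaussian 0 (1 : Matrix (Fin p) (Fin p) ℝ)).map
      (Matrix.toEuclideanCLM (𝕜 := ℝ) G)) := by rw [h]; infer_instance
  rw [Measure.pi_map_pi (μ := fun _ : Fin n => multivariateGaussian 0 1)
    (f := fun _ => Matrix.toEuclideanCLM (𝕜 := ℝ) G) (by fun_prop), h]

end Gaussian

/-! ### Rejection regions -/

section Region

variable {n p : ℕ}

/-- The samples with `(t - d) / (k + d) ≥ a`, where `t` is the squared length of `√n X̄` and `d` its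
squared distance from `K`. -/
def meanRegion (k a : ℝ) (K : Set (EuclideanSpace ℝ (Fin p))) : Set (Sample n p) :=
  {X | (1 + a) * meanDistSq K X + a * k ≤ meanLengthSq X}

variable {k a b : ℝ} {K H : Set (EuclideanSpace ℝ (Fin p))}

lemma measurableSet_meanRegion (hn : 1 ≤ n) (hK : K.Nonempty) :
    MeasurableSet (meanRegion k a K : Set (Sample n p)) :=
  measurableSet_le (((measurable_meanDistSq hn hK).const_mul _).add_const _)
    measurable_meanLengthSq

lemma meanRegion_anti (hn : 1 ≤ n) (hk : 0 ≤ k) (hab : a ≤ b) :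
    (meanRegion k b K : Set (Sample n p)) ⊆ meanRegion k a K := fun X hX => by
  have hd := meanDistSq_nonneg hn K X
  have h : (1 + b) * meanDistSq K X + b * k ≤ meanLengthSq X := hX
  change (1 + a) * meanDistSq K X + a * k ≤ meanLengthSq X
  nlinarith

lemma meanRegion_mono (hn : 1 ≤ n) (ha : 0 ≤ a) (hK : K.Nonempty) (hKH : K ⊆ H) :
    (meanRegion k a K : Set (Sample n p)) ⊆ meanRegion k a H := fun X hX => by
  have hd := meanDistSq_anti hn hK hKH X
  have h : (1 + a) * meanDistSq K X + a * k ≤ meanLengthSq X := hX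
  change (1 + a) * meanDistSq H X + a * k ≤ meanLengthSq X
  nlinarith

lemma preimage_meanRegion {G : Matrix (Fin p) (Fin p) ℝ} (hG : IsUnit G.det) :
    (fun (X : Sample n p) i => Matrix.toEuclideanCLM (𝕜 := ℝ) G (X i)) ⁻¹' meanRegion k a K =
      meanRegion k a (Matrix.toEuclideanCLM (𝕜 := ℝ) G ⁻¹' K) := by
  ext X
  simp only [meanRegion, Set.mem_preimage, Set.mem_ofPred_eq, meanDistSq_map hG,
    meanLengthSq_map hG]

lemma volume_preimage_rescaleMean_eq_zero_iff (hn : n ≠ 0) {l : ℝ} (hl : l ≠ 0)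
    {E : Set (Sample n p)} : volume (rescaleMean l ⁻¹' E) = 0 ↔ volume E = 0 := by
  refine ⟨fun h => ?_, fun h => (quasiMeasurePreserving_rescaleMean hn hl).preimage_null h⟩
  have := (quasiMeasurePreserving_rescaleMean hn (inv_ne_zero hl)).preimage_null h
  rwa [← Set.preimage_comp, show rescaleMean l ∘ rescaleMean l⁻¹ = (id : Sample n p → _) from ?_,
    Set.preimage_id] at this
  funext X
  simp [rescaleMean_rescaleMean hn, mul_inv_cancel₀ hl, rescaleMean_one]

/-- On the ray of rescalings of a sample, `l ^ 2 * (t - (1 + a) * d) = a * k > 0` has at most one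
solution `l > 0`. The rescaled copies of the boundary are therefore disjoint. If one had positive
volume, all of the uncountably many would, contradicting σ-finiteness. -/
lemma volume_meanRegion_boundary (hn : 1 ≤ n) (hk : 0 < k) (ha : 0 < a) (hK : IsClosedCone K) :
    volume {X : Sample n p | (1 + a) * meanDistSq K X + a * k = meanLengthSq X} = 0 := by
  have hn0 : n ≠ 0 := by omega
  set E := {X : Sample n p | (1 + a) * meanDistSq K X + a * k = meanLengthSq X} with hE
  have hmeas : MeasurableSet E := measurableSet_eq_fun
    (((measurable_meanDistSq hn ⟨0, hK.zero_mem⟩).const_mul _).add_const _)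
    measurable_meanLengthSq
  have hdisj : Pairwise (Function.onFun Disjoint fun l : Set.Ioi (0 : ℝ) =>
      rescaleMean (l : ℝ) ⁻¹' E) := by
    rintro ⟨l, hl⟩ ⟨m, hm⟩ hlm
    rw [Function.onFun, Set.disjoint_left]
    intro X hXl hXm
    apply hlm
    have hl0 : 0 < l := hl
    have hm0 : 0 < m := hm
    simp only [hE, Set.mem_preimage, Set.mem_ofPred_eq, meanLengthSq_rescaleMean hn0,
      meanDistSq_rescaleMean hn0 hl0 hK, meanDistSq_rescaleMean hn0 hm0 hK] at hXl hXm
    have h1 : (l ^ 2 - m ^ 2) * (meanLengthSq X - (1 + a) * meanDistSq K X) = 0 := by linarith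
    have hak : 0 < a * k := mul_pos ha hk
    rcases mul_eq_zero.1 h1 with h | h
    · exact Subtype.ext ((sq_eq_sq₀ hl0.le hm0.le).1 (sub_eq_zero.1 h))
    · nlinarith [sub_eq_zero.1 h]
  by_contra hpos
  have hcount := Measure.countable_meas_pos_of_disjoint_iUnion (μ := volume)
    (fun l : Set.Ioi (0 : ℝ) => hmeas.preimage (continuous_rescaleMean (l : ℝ)).measurable) hdisj
  have huniv : {l : Set.Ioi (0 : ℝ) | 0 < volume (rescaleMean (l : ℝ) ⁻¹' E)} = Set.univ := by
    refine Set.eq_univ_of_forall fun l => ?_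
    rw [Set.mem_ofPred_eq, pos_iff_ne_zero]
    refine fun h => hpos ?_
    exact (volume_preimage_rescaleMean_eq_zero_iff hn0 (ne_of_gt l.2)).1 h
  rw [huniv, Set.countable_univ_iff] at hcount
  have := (Set.countable_coe_iff.1 hcount).measure_zero volume
  simp at this

/-! ### Invariance of the halfspace test -/

/-- The halfspace of all vectors with nonnegative `j`-th coordinate. -/
def coordHalfspace (j : Fin p) : Set (EuclideanSpace ℝ (Fin p)) := {θ | 0 ≤ θ j}

lemma isClosedCone_coordHalfspace (j : Fin p) : IsClosedCone (coordHalfspace j) where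
  isClosed := isClosed_le continuous_const (by fun_prop)
  zero_mem := by simp [coordHalfspace]
  smul_mem c hc z hz := by simpa [coordHalfspace] using mul_nonneg hc hz

-- Take `G = B ρ` with `B` the square root of `V` and `ρ` the reflection that sends `B e` to `‖B e‖
-- • e`, where `e` is the `j`-th basis vector. Then `(G x) j = ⟪B e, ρ x⟫ = ⟪ρ (B e), x⟫ = ‖B e‖ * x
-- j`, so `G` preserves the sign of the `j`-th coordinate.
open scoped MatrixOrder in
lemma exists_mul_transpose_eq_preimage_coordHalfspace {V : Matrix (Fin p) (Fin p) ℝ}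
    (hV : V.PosDef) (j : Fin p) : ∃ G : Matrix (Fin p) (Fin p) ℝ, IsUnit G.det ∧
      G * G.transpose = V ∧
      Matrix.toEuclideanCLM (𝕜 := ℝ) G ⁻¹' coordHalfspace j = coordHalfspace j := by
  set B := Matrix.toEuclideanCLM (𝕜 := ℝ) (CFC.sqrt V) with hB
  have hBs : star B = B := by
    rw [hB, ← map_star, Matrix.star_eq_conjTranspose,
      Matrix.conjTranspose_eq_transpose_of_trivial, Matrix.transpose_sqrt]
  have hBB : B * B = Matrix.toEuclideanCLM (𝕜 := ℝ) V := by
    rw [hB, ← map_mul, hV.sqrt_mul_sqrt]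
  set e : EuclideanSpace ℝ (Fin p) := EuclideanSpace.single j 1
  have he : ‖B e‖ = ‖‖B e‖ • e‖ := by simp [e, norm_smul]
  set ρ := (ℝ ∙ (B e - ‖B e‖ • e))ᗮ.reflection
  have hρe : ρ (B e) = ‖B e‖ • e := Submodule.reflection_sub he
  have hρρ : ∀ x, ρ (ρ x) = x := Submodule.reflection_reflection _
  let R : EuclideanSpace ℝ (Fin p) →L[ℝ] EuclideanSpace ℝ (Fin p) := ρ
  have hR : R * star R = 1 := by
    have h : star R = (ρ.symm : EuclideanSpace ℝ (Fin p) →L[ℝ] EuclideanSpace ℝ (Fin p)) :=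
      LinearIsometryEquiv.adjoint_eq_symm ρ
    rw [h]
    ext1 x
    exact ρ.apply_symm_apply x
  let G := (Matrix.toEuclideanCLM (n := Fin p) (𝕜 := ℝ)).symm (B * R)
  have hG : Matrix.toEuclideanCLM (𝕜 := ℝ) G = B * R := StarAlgEquiv.apply_symm_apply _ _
  have hGG : G * G.transpose = V := by
    apply EquivLike.injective (Matrix.toEuclideanCLM (n := Fin p) (𝕜 := ℝ))
    rw [map_mul, ← Matrix.conjTranspose_eq_transpose_of_trivial, ← Matrix.star_eq_conjTranspose,
      map_star, hG, star_mul, hBs, mul_assoc, ← mul_assoc R, hR, one_mul, hBB]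
  have hGu : IsUnit G.det := by
    have h := congrArg Matrix.det hGG
    rw [Matrix.det_mul] at h
    exact isUnit_iff_ne_zero.2 (left_ne_zero_of_mul (h.trans_ne hV.det_pos.ne'))
  refine ⟨G, hGu, hGG, ?_⟩
  have he0 : e ≠ 0 := by simp [e]
  have hBe : 0 < ‖B e‖ := by
    rw [norm_pos_iff]
    exact (Matrix.toEuclideanCLE hV.isUnit_det_sqrt).map_ne_zero_iff.2 he0
  have hcoord : ∀ x : EuclideanSpace ℝ (Fin p), x j = inner ℝ e x := fun x => by
    simp [e, EuclideanSpace.inner_single_left]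
  ext x
  have : (B (ρ x)) j = ‖B e‖ * x j := by
    rw [hcoord, ← ContinuousLinearMap.adjoint_inner_left,
      ← ContinuousLinearMap.star_eq_adjoint, hBs, ← ρ.inner_map_map, hρρ, hρe,
      real_inner_smul_left, ← hcoord]
  rw [Set.mem_preimage, hG]
  change 0 ≤ (B (ρ x)) j ↔ 0 ≤ x j
  rw [this, mul_nonneg_iff_of_pos_left hBe]

/-- Null samples with dispersion `G * G.transpose` are images under `G` of standard ones, so varying
the dispersion is the same as varying the cone. -/
lemma power_meanRegion_mul_transpose (hn : 1 ≤ n) (hK : K.Nonempty)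
    {G : Matrix (Fin p) (Fin p) ℝ} (hG : IsUnit G.det) :
    power (meanRegion k a K : Set (Sample n p)) 0 (G * G.transpose) =
      power (meanRegion k a (Matrix.toEuclideanCLM (𝕜 := ℝ) G ⁻¹' K) : Set (Sample n p)) 0 1 := by
  rw [power, ← map_toEuclideanCLM_sampleLaw, Measure.map_apply (by fun_prop)
    (measurableSet_meanRegion hn hK), preimage_meanRegion hG, power]

lemma power_meanRegion_coordHalfspace (hn : 1 ≤ n) (j : Fin p) {V : Matrix (Fin p) (Fin p) ℝ}
    (hV : V.PosDef) : power (meanRegion k a (coordHalfspace j) : Set (Sample n p)) 0 V =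
      power (meanRegion k a (coordHalfspace j) : Set (Sample n p)) 0 1 := by
  obtain ⟨G, hG, hGV, hGH⟩ := exists_mul_transpose_eq_preimage_coordHalfspace hV j
  rw [← hGV, power_meanRegion_mul_transpose hn ⟨0, (isClosedCone_coordHalfspace j).zero_mem⟩ hG,
    hGH]

lemma testSize_meanRegion_coordHalfspace (hn : 1 ≤ n) (j : Fin p) :
    testSize (meanRegion k a (coordHalfspace j) : Set (Sample n p)) =
      power (meanRegion k a (coordHalfspace j) : Set (Sample n p)) 0 1 :=
  le_antisymm (iSup₂_le fun _ hV => (power_meanRegion_coordHalfspace hn j hV).le)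
    (le_iSup₂_of_le 1 Matrix.PosDef.one le_rfl)

/-! ### The size of the test against a smaller cone -/

/-- The matrix that contracts by the factor `d` towards the line through `v`, along the hyperplane
of vectors with vanishing `j`-th coordinate. -/
noncomputable def contractMatrix (j : Fin p) (v : EuclideanSpace ℝ (Fin p)) (d : ℝ) :
    Matrix (Fin p) (Fin p) ℝ :=
  d • 1 + (1 - d) • (v j)⁻¹ • Matrix.vecMulVec v.ofLp (Pi.single j 1)

lemma contractMatrix_apply (j : Fin p) (v z : EuclideanSpace ℝ (Fin p)) (d : ℝ) :
    Matrix.toEuclideanCLM (𝕜 := ℝ) (contractMatrix j v d) z =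
      d • z + (1 - d) • (z j / v j) • v := by
  ext i
  rw [Matrix.ofLp_toEuclideanCLM_apply, contractMatrix]
  simp only [Matrix.add_mulVec, Matrix.smul_mulVec, Matrix.vecMulVec_mulVec, Matrix.one_mulVec,
    single_one_dotProduct, op_smul_eq_smul, Pi.add_apply, Pi.smul_apply, PiLp.add_apply,
    PiLp.smul_apply, smul_eq_mul]
  ring

lemma isUnit_det_contractMatrix (j : Fin p) {v : EuclideanSpace ℝ (Fin p)} (hv : v j ≠ 0)
    {d : ℝ} (hd : d ≠ 0) : IsUnit (contractMatrix j v d).det := by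
  have h : contractMatrix j v d * contractMatrix j v d⁻¹ = 1 := by
    apply EquivLike.injective (Matrix.toEuclideanCLM (n := Fin p) (𝕜 := ℝ))
    ext1 z
    rw [map_mul, mul_apply_eq_comp, contractMatrix_apply, contractMatrix_apply, map_one,
      one_apply_eq_self]
    ext i
    simp
    field_simp
    ring
  exact Matrix.isUnit_det_of_right_inverse h

lemma coord_pos_of_mem_interior {j : Fin p} {C : Set (EuclideanSpace ℝ (Fin p))}
    (hsub : C ⊆ coordHalfspace j) {v : EuclideanSpace ℝ (Fin p)} (hv : v ∈ interior C) :
    0 < v j := by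
  have ht : Filter.Tendsto (fun ε : ℝ => v - ε • EuclideanSpace.single j (1 : ℝ))
      (nhdsWithin 0 (Set.Ioi 0)) (nhds v) := by
    have : Continuous fun ε : ℝ => v - ε • EuclideanSpace.single j (1 : ℝ) := by fun_prop
    simpa using (this.tendsto 0).mono_left nhdsWithin_le_nhds
  obtain ⟨ε, hε, hε0⟩ := ((ht.eventually (mem_interior_iff_mem_nhds.1 hv)).and
    self_mem_nhdsWithin).exists
  have h : 0 ≤ v j - ε := by
    have h := hsub hε
    simpa [coordHalfspace] using h
  have hε0 : 0 < ε := hε0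
  linarith

lemma posDef_mul_transpose {G : Matrix (Fin p) (Fin p) ℝ} (hG : IsUnit G.det) :
    (G * G.transpose).PosDef := by
  have h : (G * G.transpose).PosSemidef := by
    simpa [Matrix.conjTranspose_eq_transpose_of_trivial] using
      Matrix.posSemidef_self_mul_conjTranspose G
  refine h.posDef_iff_det_ne_zero.2 ?_
  rw [Matrix.det_mul, Matrix.det_transpose]
  exact mul_ne_zero hG.ne_zero hG.ne_zero

/-- Strictness leaves room to push a nearly nearest point off the bounding hyperplane. A positive `z
j` is what makes the limit `(z j / v j) • v` of its contractions an interior point of the smaller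
cone. -/
lemma exists_coord_pos_of_strict (ha : 0 < a) (j : Fin p) {X : Sample n p}
    (hX : (1 + a) * meanDistSq (coordHalfspace j) X + a * k < meanLengthSq X) :
    ∃ z : EuclideanSpace ℝ (Fin p), 0 < z j ∧
      (1 + a) * sqNorm (sampleCov X) (scaledMean X - z) + a * k < meanLengthSq X := by
  have hne : Nonempty (coordHalfspace j) := ⟨0, (isClosedCone_coordHalfspace j).zero_mem⟩
  have ha1 : 0 < 1 + a := by linarith
  have h1 : meanDistSq (coordHalfspace j) X < (meanLengthSq X - a * k) / (1 + a) := by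
    rw [lt_div_iff₀ ha1]; linarith
  obtain ⟨⟨z, hz⟩, hzlt⟩ := exists_lt_of_ciInf_lt h1
  have hc : Continuous fun ε : ℝ => sqNorm (sampleCov X)
      (scaledMean X - (z + ε • EuclideanSpace.single j (1 : ℝ))) :=
    (continuous_sqNorm _).comp (by fun_prop)
  have ht := (hc.tendsto 0).mono_left (nhdsWithin_le_nhds (s := Set.Ioi 0))
  simp only [zero_smul, add_zero] at ht
  obtain ⟨ε, hε, hε0⟩ := ((ht.eventually_lt_const hzlt).and self_mem_nhdsWithin).exists
  have hε0 : 0 < ε := hε0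
  have hz : 0 ≤ z j := hz
  refine ⟨z + ε • EuclideanSpace.single j (1 : ℝ), ?_, ?_⟩
  · simp
    linarith
  · rw [lt_div_iff₀ ha1] at hε
    linarith

lemma tendsto_contractMatrix_apply (j : Fin p) (v z : EuclideanSpace ℝ (Fin p)) :
    Filter.Tendsto (fun m : ℕ =>
      Matrix.toEuclideanCLM (𝕜 := ℝ) (contractMatrix j v (1 / ((m : ℝ) + 1))) z)
      Filter.atTop (nhds ((z j / v j) • v)) := by
  simp only [contractMatrix_apply]
  have hc : Continuous fun d : ℝ => d • z + (1 - d) • (z j / v j) • v := by fun_prop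
  simpa [Function.comp_def] using (hc.tendsto 0).comp tendsto_one_div_add_atTop_nhds_zero_nat

-- Each `A m` has, under the identity dispersion, the probability of the region of `C` under another
-- null dispersion. The contractions of any `z` with `z j > 0` end up in `C`, so a sample strictly
-- inside the halfspace region lies in `A m` for all large `m`. The boundary that this omits is
-- null.
open scoped Pointwise in
lemma power_coordHalfspace_le_testSize (hn : 1 ≤ n) (hk : 0 < k) (ha : 0 < a) (j : Fin p)
    {C : Set (EuclideanSpace ℝ (Fin p))} (hC : IsClosedCone C) (hint : (interior C).Nonempty)
    (hsub : C ⊆ coordHalfspace j) :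
    power (meanRegion k a (coordHalfspace j) : Set (Sample n p)) 0 1 ≤
      testSize (meanRegion k a C : Set (Sample n p)) := by
  obtain ⟨v, hv⟩ := hint
  have hvj := coord_pos_of_mem_interior hsub hv
  have hd : ∀ m : ℕ, (1 / ((m : ℝ) + 1)) ≠ 0 := fun m => by positivity
  have hG := fun m => isUnit_det_contractMatrix j hvj.ne' (hd m)
  set A : ℕ → Set (Sample n p) := fun m => meanRegion k a
    (Matrix.toEuclideanCLM (𝕜 := ℝ) (contractMatrix j v (1 / ((m : ℝ) + 1))) ⁻¹' C) with hA
  have hAle : ∀ m, sampleLaw n 0 1 (A m) ≤ testSize (meanRegion k a C : Set (Sample n p)) :=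
    fun m => by
      have h := power_meanRegion_mul_transpose (k := k) (a := a) hn ⟨0, hC.zero_mem⟩ (hG m)
      rw [power, power] at h
      rw [hA, ← h]
      exact le_iSup₂_of_le _ (posDef_mul_transpose (hG m)) le_rfl
  set T : Set (Sample n p) :=
    {X | (1 + a) * meanDistSq (coordHalfspace j) X + a * k < meanLengthSq X} with hT
  have hTA : T ⊆ ⋃ M, ⋂ m, ⋂ (_ : M ≤ m), A m := fun X hX => by
    obtain ⟨z, hz, hlt⟩ := exists_coord_pos_of_strict ha j hX
    have hmem : (z j / v j) • v ∈ interior C := by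
      have hc : 0 < z j / v j := div_pos hz hvj
      have hsubset : (z j / v j) • interior C ⊆ C := by
        rintro _ ⟨w, hw, rfl⟩
        exact hC.smul_mem _ hc.le w (interior_subset hw)
      exact interior_maximal hsubset (isOpen_interior.smul₀ hc.ne')
        (Set.smul_mem_smul_set hv)
    obtain ⟨M, hM⟩ := Filter.eventually_atTop.1 ((tendsto_contractMatrix_apply j v z).eventually
      (mem_interior_iff_mem_nhds.1 hmem))
    refine Set.mem_iUnion.2 ⟨M, Set.mem_iInter₂.2 fun m hm => ?_⟩
    have h := meanDistSq_le hn X (K := Matrix.toEuclideanCLM (𝕜 := ℝ)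
      (contractMatrix j v (1 / ((m : ℝ) + 1))) ⁻¹' C) (hM m hm)
    have h' := mul_le_mul_of_nonneg_left h (by linarith : 0 ≤ 1 + a)
    change (1 + a) * meanDistSq _ X + a * k ≤ meanLengthSq X
    linarith
  -- Tail intersections increase by construction, so continuity from below applies without
  -- monotonicity of `A`.
  have hmono : Monotone fun M => ⋂ m, ⋂ (_ : M ≤ m), A m := fun M M' h =>
    Set.iInter_mono fun m => Set.iInter_mono' fun hm => ⟨h.trans hm, le_rfl⟩
  have hHT : (meanRegion k a (coordHalfspace j) : Set (Sample n p)) ⊆ T ∪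
      {X | (1 + a) * meanDistSq (coordHalfspace j) X + a * k = meanLengthSq X} := fun X hX =>
    lt_or_eq_of_le (show (1 + a) * meanDistSq (coordHalfspace j) X + a * k ≤ meanLengthSq X
      from hX)
  have hnull := sampleLaw_absolutelyContinuous (V := 1) Matrix.PosDef.one 0
    (volume_meanRegion_boundary (n := n) hn hk ha (isClosedCone_coordHalfspace j))
  calc power (meanRegion k a (coordHalfspace j) : Set (Sample n p)) 0 1
      ≤ sampleLaw n 0 1 T := by
        refine (measure_mono hHT).trans ((measure_union_le _ _).trans ?_)
        rw [hnull, add_zero]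
    _ ≤ sampleLaw n 0 1 (⋃ M, ⋂ m, ⋂ (_ : M ≤ m), A m) := measure_mono hTA
    _ = ⨆ M, sampleLaw n 0 1 (⋂ m, ⋂ (_ : M ≤ m), A m) := hmono.measure_iUnion
    _ ≤ _ := iSup_le fun M =>
        (measure_mono (Set.iInter₂_subset M le_rfl)).trans (hAle M)

end Region

/-! ### Domination -/

section Domination

variable {n p : ℕ} {k a b : ℝ}

lemma power_congr_ae {W W' : Set (Sample n p)} (h : W =ᵐ[volume] W')
    (θ : EuclideanSpace ℝ (Fin p)) {V : Matrix (Fin p) (Fin p) ℝ} (hV : V.PosDef) :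
    power W θ V = power W' θ V :=
  measure_congr ((sampleLaw_absolutelyContinuous hV θ).ae_eq h)

lemma testSize_congr_ae {W W' : Set (Sample n p)} (h : W =ᵐ[volume] W') :
    testSize W = testSize W' :=
  iSup_congr fun _ => iSup_congr fun hV => power_congr_ae h 0 hV

lemma testSize_univ : testSize (Set.univ : Set (Sample n p)) = 1 := by
  refine le_antisymm (iSup₂_le fun V _ => ?_) (le_iSup₂_of_le 1 Matrix.PosDef.one ?_)
  · exact (measure_univ (μ := sampleLaw n 0 V)).le
  · exact (measure_univ (μ := sampleLaw n 0 1)).ge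

lemma testSize_empty : testSize (∅ : Set (Sample n p)) = 0 := by
  simp [testSize, power]

/-- The regions are nested in the threshold, and the size is a probability under one fixed law
equivalent to `volume`. Nested sets of equal finite measure differ by a null set, so strict
monotonicity of the size is not needed. -/
lemma meanRegion_coordHalfspace_ae_eq (hn : 1 ≤ n) (hk : 0 ≤ k) (j : Fin p)
    (h : testSize (meanRegion k a (coordHalfspace j) : Set (Sample n p)) =
      testSize (meanRegion k b (coordHalfspace j) : Set (Sample n p))) :
    (meanRegion k a (coordHalfspace j) : Set (Sample n p)) =ᵐ[volume]
      meanRegion k b (coordHalfspace j) := by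
  wlog hab : b ≤ a generalizing a b
  · exact (this h.symm (le_of_not_ge hab)).symm
  rw [testSize_meanRegion_coordHalfspace hn, testSize_meanRegion_coordHalfspace hn] at h
  have hac := volume_absolutelyContinuous_sampleLaw (n := n)
    (V := (1 : Matrix (Fin p) (Fin p) ℝ)) Matrix.PosDef.one 0
  exact hac.ae_eq (ae_eq_of_subset_of_measure_ge (meanRegion_anti hn hk hab) h.ge
    (measurableSet_meanRegion hn ⟨0, (isClosedCone_coordHalfspace j).zero_mem⟩).nullMeasurableSet
    (measure_ne_top _ _))

lemma exists_mem_coordHalfspace_notMem {j : Fin p} {C : Set (EuclideanSpace ℝ (Fin p))}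
    (hC : IsClosed C) (hsub : C ⊆ coordHalfspace j) (hne : C ≠ coordHalfspace j) :
    ∃ z : EuclideanSpace ℝ (Fin p), 0 < z j ∧ z ∉ C := by
  by_contra! h
  refine hne (hsub.antisymm fun z hz => ?_)
  have ht : Filter.Tendsto (fun ε : ℝ => z + ε • EuclideanSpace.single j (1 : ℝ))
      (nhdsWithin 0 (Set.Ioi 0)) (nhds z) := by
    have : Continuous fun ε : ℝ => z + ε • EuclideanSpace.single j (1 : ℝ) := by fun_prop
    simpa using (this.tendsto 0).mono_left nhdsWithin_le_nhds
  refine hC.mem_of_tendsto ht ?_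
  filter_upwards [self_mem_nhdsWithin] with ε hε
  refine h _ ?_
  have h1 : 0 < ε := hε
  have h2 : 0 ≤ z j := hz
  simp
  linarith

/-- The samples with scaled mean in the open halfspace but outside `C` form a nonempty open set `F`.
Almost every sample in `F` has distance zero to the halfspace and positive distance to `C`, so some
rational rescaling carries it into the difference `E`. Were `E` null, countably many null sets would
cover almost all of `F`. -/
lemma volume_meanRegion_diff_ne_zero (hnp : p < n) (hk : 0 < k) (ha : 0 < a) {j : Fin p}
    {C : Set (EuclideanSpace ℝ (Fin p))} (hC : IsClosedCone C)
    (hsub : C ⊆ coordHalfspace j) (hne : C ≠ coordHalfspace j) :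
    volume (meanRegion k a (coordHalfspace j) \ meanRegion k a C : Set (Sample n p)) ≠ 0 := by
  have hn : 1 ≤ n := by omega
  have hn0 : n ≠ 0 := by omega
  set E : Set (Sample n p) := meanRegion k a (coordHalfspace j) \ meanRegion k a C with hE
  intro hnull
  obtain ⟨z, hz, hzC⟩ := exists_mem_coordHalfspace_notMem hC.isClosed hsub hne
  set F : Set (Sample n p) := {X | 0 < scaledMean X j ∧ scaledMean X ∉ C} with hF
  have hFopen : IsOpen F := by
    have hc := continuous_scaledMean (n := n) (p := p)
    have hcj : Continuous fun X : Sample n p => scaledMean X j := by fun_prop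
    exact (isOpen_lt continuous_const hcj).inter
      (hC.isClosed.isOpen_compl.preimage hc)
  have hsn : Real.sqrt n ≠ 0 := by
    rw [Real.sqrt_ne_zero']
    exact_mod_cast (by omega : 0 < n)
  have hn0' : (n : ℝ) ≠ 0 := by exact_mod_cast hn0
  have hFne : F.Nonempty := by
    have h : scaledMean (fun _ : Fin n => (Real.sqrt n)⁻¹ • z) = z := by
      simp [scaledMean, sampleMean, ← Nat.cast_smul_eq_nsmul ℝ, smul_smul]
      rw [inv_mul_cancel_left₀ hn0', mul_inv_cancel₀ hsn, one_smul]
    exact ⟨_, by rw [hF, Set.mem_ofPred_eq, h]; exact ⟨hz, hzC⟩⟩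
  have hU : volume (⋃ l : {l : ℚ // 0 < l}, rescaleMean ((l : ℚ) : ℝ) ⁻¹' E) = 0 := by
    refine measure_iUnion_null fun l => ?_
    have hl : (((l : ℚ) : ℝ)) ≠ 0 := by exact_mod_cast l.2.ne'
    exact (volume_preimage_rescaleMean_eq_zero_iff hn0 hl).2 hnull
  have hPD := ae_posDef_sampleCov hnp
  refine (hFopen.measure_pos volume hFne).ne' (measure_mono_null_ae ?_ hU)
  filter_upwards [hPD] with X hX hXF
  obtain ⟨hXj, hXC⟩ := hXF
  have hH : meanDistSq (coordHalfspace j) X = 0 := by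
    refine le_antisymm ?_ (meanDistSq_nonneg hn _ X)
    have h : scaledMean X ∈ coordHalfspace j := hXj.le
    simpa [sqNorm_zero] using meanDistSq_le hn X h
  have hCpos : 0 < meanDistSq C X := by
    obtain ⟨w, hw, -, hwd⟩ := exists_sqNorm_eq_meanDistSq hC.isClosed ⟨0, hC.zero_mem⟩ hX
    rw [hwd]
    exact sqNorm_pos hX (sub_ne_zero.2 fun h => hXC (h ▸ hw))
  have ht : 0 < meanLengthSq X :=
    hCpos.trans_le (meanDistSq_le_meanLengthSq hn hC.zero_mem X)
  set t := meanLengthSq X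
  set r := meanDistSq C X
  have hak : 0 < a * k := mul_pos ha hk
  -- At `s = √(a * k / t)` the halfspace test is exactly at its threshold while the test against `C`
  -- is strictly below; a rational slightly above `s` keeps both properties.
  obtain ⟨l, hl0, hl1, hl2⟩ : ∃ l : ℚ, 0 < l ∧ a * k ≤ (l : ℝ) ^ 2 * t ∧
      (l : ℝ) ^ 2 * (t - (1 + a) * r) < a * k := by
    have hcont : Continuous fun x : ℝ => x ^ 2 * (t - (1 + a) * r) := by fun_prop
    set s := Real.sqrt (a * k / t) with hs
    have hs2 : s ^ 2 = a * k / t := Real.sq_sqrt (by positivity)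
    have hs0 : 0 < s := Real.sqrt_pos.2 (by positivity)
    have hlt : s ^ 2 * (t - (1 + a) * r) < a * k := by
      have h1 : s ^ 2 * t = a * k := by rw [hs2, div_mul_cancel₀ _ ht.ne']
      have h2 : 0 < s ^ 2 * ((1 + a) * r) := by positivity
      linarith
    have hev : ∀ᶠ x in nhdsWithin s (Set.Ioi s), x ^ 2 * (t - (1 + a) * r) < a * k :=
      ((hcont.tendsto s).mono_left nhdsWithin_le_nhds).eventually_lt_const hlt
    obtain ⟨u, hu, huI⟩ := mem_nhdsGT_iff_exists_Ioo_subset.1 hev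
    obtain ⟨l, hsl, hlu⟩ := exists_rat_btwn (show s < u from hu)
    refine ⟨l, by exact_mod_cast hs0.trans hsl, ?_, huI ⟨hsl, hlu⟩⟩
    have h1 : s ^ 2 * t = a * k := by rw [hs2, div_mul_cancel₀ _ ht.ne']
    rw [← h1]
    gcongr
  have hl0' : (0 : ℝ) < l := by exact_mod_cast hl0
  refine Set.mem_iUnion.2 ⟨⟨l, hl0⟩, ?_⟩
  have hmem : ∀ K : Set (EuclideanSpace ℝ (Fin p)), IsClosedCone K →
      (rescaleMean (l : ℝ) X ∈ (meanRegion k a K : Set (Sample n p)) ↔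
        (1 + a) * ((l : ℝ) ^ 2 * meanDistSq K X) + a * k ≤ (l : ℝ) ^ 2 * t) := fun K hK => by
    rw [meanRegion, Set.mem_ofPred_eq, meanDistSq_rescaleMean hn0 hl0' hK,
      meanLengthSq_rescaleMean hn0]
  refine ⟨(hmem _ (isClosedCone_coordHalfspace j)).2 ?_, fun h => ?_⟩
  · rw [hH]; linarith
  · have := (hmem _ hC).1 h
    change _ * (_ * r) + _ ≤ _ at this
    linarith

/-- The threshold `a` in `hstat` serves all cones at once, which gives equality of sizes at a common
critical value. The two degenerate alternatives have size `1` and `0` and do not occur at levels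
strictly between. -/
theorem testDominated_of_critRegion_ae_eq {β : Type*} [LE β]
    {stat : Set (EuclideanSpace ℝ (Fin p)) → Sample n p → β} (hnp : p < n) (hk : 0 < k)
    {j : Fin p} {C : Set (EuclideanSpace ℝ (Fin p))} (hC : IsClosedCone C)
    (hint : (interior C).Nonempty) (hsub : C ⊆ coordHalfspace j)
    (hstat : ∀ c : β,
      (∀ K, IsClosedCone K → critRegion (stat K) c =ᵐ[volume] (Set.univ : Set (Sample n p))) ∨
      (∀ K, IsClosedCone K → critRegion (stat K) c =ᵐ[volume] (∅ : Set (Sample n p))) ∨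
      ∃ a : ℝ, 0 < a ∧ ∀ K, IsClosedCone K →
        critRegion (stat K) c =ᵐ[volume] (meanRegion k a K : Set (Sample n p))) :
    TestDominated stat C (coordHalfspace j) := by
  have hn : 1 ≤ n := by omega
  have hH := isClosedCone_coordHalfspace j
  have hCne : C.Nonempty := ⟨0, hC.zero_mem⟩
  have hregion : ∀ a, 0 < a → testSize (meanRegion k a C : Set (Sample n p)) =
      testSize (meanRegion k a (coordHalfspace j) : Set (Sample n p)) := fun a ha => by
    refine le_antisymm (iSup₂_mono fun V _ => measure_mono (meanRegion_mono hn ha.le hCne hsub)) ?_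
    rw [testSize_meanRegion_coordHalfspace hn]
    exact power_coordHalfspace_le_testSize hn hk ha j hC hint hsub
  have hlevel : ∀ α : ℝ≥0∞, 0 < α → α < 1 → ∀ c K, IsClosedCone K →
      testSize (critRegion (stat K) c) = α → ∃ a : ℝ, 0 < a ∧ ∀ K, IsClosedCone K →
        critRegion (stat K) c =ᵐ[volume] (meanRegion k a K : Set (Sample n p)) := by
    intro α hα0 hα1 c K hK hc
    rcases hstat c with h | h | h
    · rw [testSize_congr_ae (h K hK), testSize_univ] at hc
      exact absurd hc hα1.ne'
    · rw [testSize_congr_ae (h K hK), testSize_empty] at hc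
      exact absurd hc hα0.ne
    · exact h
  have hpair : ∀ α : ℝ≥0∞, 0 < α → α < 1 → ∀ c d,
      testSize (critRegion (stat C) c) = α → testSize (critRegion (stat (coordHalfspace j)) d) = α →
      ∃ a : ℝ, 0 < a ∧ critRegion (stat C) c =ᵐ[volume] (meanRegion k a C : Set (Sample n p)) ∧
        critRegion (stat (coordHalfspace j)) d =ᵐ[volume]
          (meanRegion k a (coordHalfspace j) : Set (Sample n p)) := by
    intro α hα0 hα1 c d hc hd
    obtain ⟨a, ha, hac⟩ := hlevel α hα0 hα1 c C hC hc
    obtain ⟨b, hb, hbd⟩ := hlevel α hα0 hα1 d _ hH hd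
    -- The halfspace regions with thresholds `a` and `b` both have size `α`, so `b` may be replaced
    -- by `a`.
    refine ⟨a, ha, hac C hC, (hbd _ hH).trans (meanRegion_coordHalfspace_ae_eq hn hk.le j ?_)⟩
    rw [← testSize_congr_ae (hbd _ hH), hd, ← hregion a ha, ← testSize_congr_ae (hac C hC), hc]
  refine ⟨fun c => ?_, fun α hα0 hα1 c d hc hd θ V hV => ?_, fun hne α hα0 hα1 c d hc hd => ?_⟩
  · rcases hstat c with h | h | ⟨a, ha, h⟩
    · exact testSize_congr_ae ((h C hC).trans (h _ hH).symm)
    · exact testSize_congr_ae ((h C hC).trans (h _ hH).symm)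
    · rw [testSize_congr_ae (h C hC), testSize_congr_ae (h _ hH), hregion a ha]
  · obtain ⟨a, ha, hCa, hHa⟩ := hpair α hα0 hα1 c d hc hd
    rw [power_congr_ae hCa θ hV, power_congr_ae hHa θ hV]
    exact measure_mono (meanRegion_mono hn ha.le hCne hsub)
  · obtain ⟨a, ha, hCa, hHa⟩ := hpair α hα0 hα1 c d hc hd
    obtain ⟨v, hv⟩ := hint
    have hvj := coord_pos_of_mem_interior hsub hv
    -- Any nonzero point of `C` and any positive definite dispersion would do, since every sample
    -- law charges the difference of the regions.
    refine ⟨v, ⟨interior_subset hv, fun h => ?_⟩, 1, Matrix.PosDef.one, ?_⟩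
    · rw [Set.mem_singleton_iff] at h
      simp [h] at hvj
    · rw [power_congr_ae hCa v Matrix.PosDef.one, power_congr_ae hHa v Matrix.PosDef.one]
      have hdiff := (mt fun h => volume_absolutelyContinuous_sampleLaw (n := n)
        (V := (1 : Matrix (Fin p) (Fin p) ℝ)) Matrix.PosDef.one v h)
        (volume_meanRegion_diff_ne_zero (k := k) (a := a) hnp hk ha hC hsub hne)
      rw [measure_sdiff (meanRegion_mono hn ha.le hCne hsub)
        (measurableSet_meanRegion hn hCne).nullMeasurableSet (measure_ne_top _ _)] at hdiff
      exact tsub_pos_iff_lt.1 (pos_iff_ne_zero.2 hdiff)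

end Domination

/-! ### The projection statistic -/

section ProjStat

variable {n p : ℕ}

open scoped MatrixOrder in
lemma exists_sqNorm_sub_smul {A : Matrix (Fin p) (Fin p) ℝ} (hA : A.PosDef)
    (y w : EuclideanSpace ℝ (Fin p)) :
    ∃ b, ∀ s : ℝ, sqNorm A (y - s • w) = sqNorm A y - 2 * s * b + s ^ 2 * sqNorm A w := by
  refine ⟨inner ℝ (Matrix.toEuclideanCLE hA.inv.isUnit_det_sqrt y)
    (Matrix.toEuclideanCLE hA.inv.isUnit_det_sqrt w), fun s => ?_⟩
  simp only [sqNorm_eq_norm_sq hA]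
  rw [map_sub, map_smul, norm_sub_sq_real, real_inner_smul_right, norm_smul, mul_pow,
    Real.norm_eq_abs, sq_abs]
  ring

/-- The whole ray through `w` lies in `K`, so the quadratic `s ↦ ‖y - s w‖²` is minimal over `s ≥ 0`
at `s = 1`. This forces `y - w` to be orthogonal to `w`, and Pythagoras applies. -/
lemma sqNorm_of_isNearest {A : Matrix (Fin p) (Fin p) ℝ} (hA : A.PosDef)
    {K : Set (EuclideanSpace ℝ (Fin p))} (hK : IsClosedCone K) {y w : EuclideanSpace ℝ (Fin p)}
    (hw : w ∈ K) (hmin : ∀ z ∈ K, sqNorm A (y - w) ≤ sqNorm A (y - z)) :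
    sqNorm A w = sqNorm A y - sqNorm A (y - w) := by
  obtain ⟨b, hb⟩ := exists_sqNorm_sub_smul hA y w
  set q := sqNorm A w with hq
  have hq0 : 0 ≤ q := sqNorm_nonneg hA.posSemidef w
  have h1 : sqNorm A (y - w) = sqNorm A y - 2 * b + q := by simpa using hb 1
  have hs : ∀ s : ℝ, 0 ≤ s → -2 * b + q ≤ -2 * s * b + s ^ 2 * q := fun s hs => by
    have := hmin _ (hK.smul_mem s hs w hw)
    rw [h1, hb s] at this
    linarith
  suffices h : q = b by linarith
  rcases hq0.eq_or_lt with h0 | hpos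
  · have h2 := hs 0 le_rfl
    have h3 := hs 2 (by norm_num)
    linarith
  · have hb0 : 0 ≤ b := by
      have h2 := hs 0 le_rfl
      linarith
    -- `b / q` is the vertex of the parabola; comparison with `s = 1` yields `(q - b) ^ 2 ≤ 0`.
    have h2 := hs (b / q) (div_nonneg hb0 hq0)
    have h3 : -2 * (b / q) * b + (b / q) ^ 2 * q = -(b ^ 2) / q := by field_simp; ring
    rw [h3, le_div_iff₀ hpos] at h2
    nlinarith [sq_nonneg (q - b)]

lemma projStat_eq {K : Set (EuclideanSpace ℝ (Fin p))} (hK : IsClosedCone K) {X : Sample n p}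
    (hX : (sampleCov X).PosDef) :
    projStat K X = (meanLengthSq X - meanDistSq K X) / (1 + meanDistSq K X) := by
  obtain ⟨z, hz, hzmin, hzd⟩ := exists_sqNorm_eq_meanDistSq hK.isClosed ⟨0, hK.zero_mem⟩ hX
  have hex : ∃ w ∈ K, ∀ z ∈ K, sqNorm (sampleCov X) (scaledMean X - w) ≤
    sqNorm (sampleCov X) (scaledMean X - z) := ⟨z, hz, hzmin⟩
  have hpi : coneProj (sampleCov X) K (scaledMean X) = hex.choose := dif_pos hex
  obtain ⟨hw, hwmin⟩ := hex.choose_spec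
  have hd : sqNorm (sampleCov X) (scaledMean X - hex.choose) = meanDistSq K X :=
    (hwmin z hz |>.trans hzd.ge).antisymm (hzd.le.trans (hzmin _ hw))
  change sqNorm _ (coneProj (sampleCov X) K (scaledMean X)) /
    (1 + sqNorm _ (scaledMean X - coneProj (sampleCov X) K (scaledMean X))) = _
  rw [hpi, sqNorm_of_isNearest hX hK hw hwmin, hd, meanLengthSq]

lemma critRegion_projStat_ae_eq (hnp : p < n) (c : ℝ) :
    (∀ K, IsClosedCone K →
      critRegion (projStat K) c =ᵐ[volume] (Set.univ : Set (Sample n p))) ∨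
    (∀ K, IsClosedCone K →
      critRegion (projStat K) c =ᵐ[volume] (∅ : Set (Sample n p))) ∨
    ∃ a : ℝ, 0 < a ∧ ∀ K, IsClosedCone K →
      critRegion (projStat K) c =ᵐ[volume] (meanRegion 1 a K : Set (Sample n p)) := by
  have hn : 1 ≤ n := by omega
  rcases le_or_gt c 0 with hc | hc
  · refine Or.inl fun K hK => Filter.eventuallyEq_set.2 ?_
    filter_upwards [ae_posDef_sampleCov hnp] with X hX
    refine iff_of_true ?_ (Set.mem_univ X)
    change c ≤ projStat K X
    rw [projStat_eq hK hX]
    have h1 := meanDistSq_nonneg hn K X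
    have h2 := meanDistSq_le_meanLengthSq hn hK.zero_mem X
    exact hc.trans (div_nonneg (by linarith) (by linarith))
  · refine Or.inr (Or.inr ⟨c, hc, fun K hK => Filter.eventuallyEq_set.2 ?_⟩)
    filter_upwards [ae_posDef_sampleCov hnp] with X hX
    change c ≤ projStat K X ↔ (1 + c) * meanDistSq K X + c * 1 ≤ meanLengthSq X
    have h1 := meanDistSq_nonneg hn K X
    rw [projStat_eq hK hX, le_div_iff₀ (by linarith)]
    constructor <;> intro h <;> linarith

end ProjStat

/-! ### The likelihood ratio statistic -/

section LikelihoodRatio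

variable {n p : ℕ}

/-- Multiply `x ≤ exp (x - 1)` over the eigenvalues. -/
lemma Matrix.PosSemidef.det_le_exp_trace_sub {B : Matrix (Fin p) (Fin p) ℝ}
    (hB : B.PosSemidef) : B.det ≤ Real.exp (B.trace - p) := by
  have h1 : B.det = ∏ i, hB.isHermitian.eigenvalues i := by
    simpa using hB.isHermitian.det_eq_prod_eigenvalues
  have h2 : B.trace = ∑ i, hB.isHermitian.eigenvalues i := by
    simpa using hB.isHermitian.trace_eq_sum_eigenvalues
  have h3 : B.trace - p = ∑ i, (hB.isHermitian.eigenvalues i - 1) := by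
    simp [h2]
  rw [h1, h3, Real.exp_sum]
  refine Finset.prod_le_prod (fun i _ => hB.eigenvalues_nonneg i) fun i _ => ?_
  have := Real.add_one_le_exp (hB.isHermitian.eigenvalues i - 1)
  linarith

-- The eigenvalue bound for `N^(1/2) V⁻¹ N^(1/2)`. It is the inequality behind the maximum
-- likelihood estimate of a dispersion matrix.
open scoped MatrixOrder in
lemma det_le_det_mul_exp_trace {N V : Matrix (Fin p) (Fin p) ℝ} (hN : N.PosDef)
    (hV : V.PosDef) : N.det ≤ V.det * Real.exp ((V⁻¹ * N).trace - p) := by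
  have hB : (CFC.sqrt N * V⁻¹ * CFC.sqrt N).PosSemidef := by
    have := hV.inv.posSemidef.mul_mul_conjTranspose_same (CFC.sqrt N)
    rwa [Matrix.conjTranspose_eq_transpose_of_trivial, Matrix.transpose_sqrt] at this
  have h := hB.det_le_exp_trace_sub
  have htr : (CFC.sqrt N * V⁻¹ * CFC.sqrt N).trace = (V⁻¹ * N).trace := by
    rw [Matrix.mul_assoc, Matrix.trace_mul_comm, Matrix.mul_assoc, hN.sqrt_mul_sqrt]
  have hdet : (CFC.sqrt N * V⁻¹ * CFC.sqrt N).det = N.det / V.det := by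
    rw [Matrix.det_mul, Matrix.det_mul, mul_right_comm, ← Matrix.det_mul, hN.sqrt_mul_sqrt,
      Matrix.det_nonsing_inv, Ring.inverse_eq_inv', div_eq_mul_inv]
  rw [htr, hdet, div_le_iff₀ hV.det_pos] at h
  linarith

/-- The maximum likelihood estimate of the dispersion matrix for a given mean. -/
noncomputable def dispersionMLE (X : Sample n p) (θ : EuclideanSpace ℝ (Fin p)) :
    Matrix (Fin p) (Fin p) ℝ :=
  (n : ℝ)⁻¹ • ∑ i, Matrix.vecMulVec (X i - θ).ofLp (X i - θ).ofLp

lemma sum_sqNorm_eq_trace (hn : n ≠ 0) (X : Sample n p) (θ : EuclideanSpace ℝ (Fin p))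
    (V : Matrix (Fin p) (Fin p) ℝ) :
    ∑ i, sqNorm V (X i - θ) = n * (V⁻¹ * dispersionMLE X θ).trace := by
  have h : (n : ℝ) ≠ 0 := by exact_mod_cast hn
  rw [dispersionMLE, Matrix.mul_smul, Matrix.trace_smul, smul_eq_mul, mul_inv_cancel_left₀ h,
    Matrix.mul_sum, Matrix.trace_sum]
  refine Finset.sum_congr rfl fun i _ => ?_
  rw [Matrix.mul_vecMulVec, Matrix.trace_vecMulVec, sqNorm, dotProduct_comm]

lemma likelihood_eq (hn : n ≠ 0) (X : Sample n p) (θ : EuclideanSpace ℝ (Fin p))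
    (V : Matrix (Fin p) (Fin p) ℝ) :
    likelihood X θ V = ((Real.sqrt ((2 * Real.pi) ^ p * V.det))⁻¹ *
      Real.exp (-(V⁻¹ * dispersionMLE X θ).trace / 2)) ^ n := by
  rw [likelihood, Finset.prod_mul_distrib, ← Real.exp_sum, Finset.prod_const, Finset.card_univ,
    Fintype.card_fin, mul_pow (Real.sqrt _)⁻¹, ← Real.exp_nat_mul, ← Finset.sum_div,
    Finset.sum_neg_distrib, sum_sqNorm_eq_trace hn]
  ring_nf

lemma likelihood_le (hn : n ≠ 0) {X : Sample n p} {θ : EuclideanSpace ℝ (Fin p)}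
    (hN : (dispersionMLE X θ).PosDef) {V : Matrix (Fin p) (Fin p) ℝ} (hV : V.PosDef) :
    likelihood X θ V ≤ likelihood X θ (dispersionMLE X θ) := by
  rw [likelihood_eq hn, likelihood_eq hn]
  set N := dispersionMLE X θ
  refine pow_le_pow_left₀ (by positivity) ?_ n
  have hVd := hV.det_pos
  have hNd := hN.det_pos
  have hpi : 0 < (2 * Real.pi) ^ p := by positivity
  rw [Matrix.nonsing_inv_mul N hN.det_pos.ne'.isUnit, Matrix.trace_one, Fintype.card_fin]
  have h := det_le_det_mul_exp_trace hN hV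
  set τ := (V⁻¹ * N).trace
  rw [inv_mul_le_iff₀ (by positivity), mul_left_comm, ← div_eq_inv_mul, le_div_iff₀ (by positivity),
    ← pow_le_pow_iff_left₀ (by positivity) (by positivity) two_ne_zero,
    mul_pow (Real.exp _), mul_pow (Real.sqrt _), Real.sq_sqrt (by positivity), Real.sq_sqrt (by positivity),
    ← Real.exp_nat_mul,
    ← Real.exp_nat_mul]
  have h1 : Real.exp ((2 : ℕ) * (-τ / 2)) * Real.exp (τ - p) = Real.exp ((2 : ℕ) * (-p / 2)) := by
    rw [← Real.exp_add]
    congr 1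
    push_cast
    ring
  rw [← h1]
  calc Real.exp ((2 : ℕ) * (-τ / 2)) * ((2 * Real.pi) ^ p * N.det)
      ≤ Real.exp ((2 : ℕ) * (-τ / 2)) * ((2 * Real.pi) ^ p * (V.det * Real.exp (τ - p))) := by
        gcongr
    _ = _ := by ring

lemma dispersionMLE_eq (hn : 2 ≤ n) (X : Sample n p) (θ : EuclideanSpace ℝ (Fin p)) :
    dispersionMLE X θ = (((n : ℝ) - 1) / n) • sampleCov X +
      Matrix.vecMulVec (sampleMean X - θ).ofLp (sampleMean X - θ).ofLp := by
  have hn0 : (n : ℝ) ≠ 0 := by exact_mod_cast (by omega : n ≠ 0)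
  have hn1 : (n : ℝ) - 1 ≠ 0 := by
    have : (2 : ℝ) ≤ n := by exact_mod_cast hn
    linarith
  ext j k
  have hs : ∀ j, ∑ i, X i j = n * sampleMean X j := fun j => by
    simp [sampleMean, mul_inv_cancel_left₀ hn0]
  simp only [dispersionMLE, sampleCov, Matrix.add_apply, Matrix.smul_apply, Matrix.sum_apply,
    Matrix.vecMulVec_apply, smul_eq_mul, PiLp.sub_apply, sub_mul, mul_sub,
    Finset.sum_sub_distrib, ← Finset.mul_sum, ← Finset.sum_mul, hs, Finset.sum_const,
    Finset.card_univ, Fintype.card_fin, nsmul_eq_mul]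
  field_simp
  ring

lemma posDef_dispersionMLE (hn : 2 ≤ n) {X : Sample n p} (hX : (sampleCov X).PosDef)
    (θ : EuclideanSpace ℝ (Fin p)) : (dispersionMLE X θ).PosDef := by
  rw [dispersionMLE_eq hn]
  have : (2 : ℝ) ≤ n := by exact_mod_cast hn
  refine (hX.smul (div_pos (by linarith) (by linarith))).add_posSemidef ?_
  simpa using Matrix.posSemidef_vecMulVec_self_star (R := ℝ) (sampleMean X - θ).ofLp

/-- Factor out `A` and use the determinant of a rank-one perturbation of the identity. -/
lemma det_add_vecMulVec_self {A : Matrix (Fin p) (Fin p) ℝ} (hA : IsUnit A.det)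
    (u : EuclideanSpace ℝ (Fin p)) :
    (A + Matrix.vecMulVec u.ofLp u.ofLp).det = A.det * (1 + sqNorm A u) := by
  have h : A + Matrix.vecMulVec u.ofLp u.ofLp =
      A * (1 + Matrix.replicateCol Unit (A⁻¹.mulVec u.ofLp) * Matrix.replicateRow Unit u.ofLp) := by
    rw [← Matrix.vecMulVec_eq, Matrix.mul_add, Matrix.mul_one, Matrix.mul_vecMulVec,
      Matrix.mulVec_mulVec, Matrix.mul_nonsing_inv A hA, Matrix.one_mulVec]
  rw [h, Matrix.det_mul, Matrix.det_one_add_replicateCol_mul_replicateRow, sqNorm]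

lemma det_dispersionMLE (hn : 2 ≤ n) {X : Sample n p} (hX : (sampleCov X).PosDef)
    (θ : EuclideanSpace ℝ (Fin p)) :
    (dispersionMLE X θ).det = ((((n : ℝ) - 1) / n) • sampleCov X).det *
      (1 + sqNorm (sampleCov X) (scaledMean X - Real.sqrt n • θ) / (n - 1)) := by
  have : (2 : ℝ) ≤ n := by exact_mod_cast hn
  have hA := hX.smul (div_pos (by linarith : 0 < (n : ℝ) - 1) (by linarith : 0 < (n : ℝ)))
  rw [dispersionMLE_eq hn, det_add_vecMulVec_self hA.det_pos.ne'.isUnit,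
    sqNorm_smul_matrix _ _ hX.det_pos.ne'.isUnit, scaledMean, ← smul_sub, sqNorm_smul,
    Real.sq_sqrt (Nat.cast_nonneg n)]
  congr 2
  rw [inv_div]
  ring

/-- The maximum of the likelihood over all dispersion matrices, as a function of the squared
distance between `√n X̄` and `√n θ` in the norm of the sample covariance. -/
noncomputable def profileLikelihood (X : Sample n p) (s : ℝ) : ℝ :=
  ((Real.sqrt ((2 * Real.pi) ^ p * (((((n : ℝ) - 1) / n) • sampleCov X).det *
    (1 + s / (n - 1)))))⁻¹ * Real.exp (-p / 2)) ^ n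

lemma likelihood_dispersionMLE (hn : 2 ≤ n) {X : Sample n p} (hX : (sampleCov X).PosDef)
    (θ : EuclideanSpace ℝ (Fin p)) : likelihood X θ (dispersionMLE X θ) =
      profileLikelihood X (sqNorm (sampleCov X) (scaledMean X - Real.sqrt n • θ)) := by
  have hN := posDef_dispersionMLE hn hX θ
  rw [likelihood_eq (by omega), Matrix.nonsing_inv_mul _ hN.det_pos.ne'.isUnit, Matrix.trace_one,
    Fintype.card_fin, det_dispersionMLE hn hX, profileLikelihood]

lemma profileLikelihood_eq (hn : 2 ≤ n) {X : Sample n p} (hX : (sampleCov X).PosDef) (s : ℝ) :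
    profileLikelihood X s = profileLikelihood X 0 * ((Real.sqrt (1 + s / (n - 1)))⁻¹) ^ n := by
  simp only [profileLikelihood, zero_div, add_zero, mul_one]
  have : (2 : ℝ) ≤ n := by exact_mod_cast hn
  have hA := (hX.smul (div_pos (by linarith : 0 < (n : ℝ) - 1)
    (by linarith : 0 < (n : ℝ)))).det_pos
  rw [← mul_assoc ((2 * Real.pi) ^ p), Real.sqrt_mul (by positivity), mul_inv, ← mul_pow,
    mul_right_comm]

lemma profileLikelihood_zero_pos (hn : 2 ≤ n) {X : Sample n p} (hX : (sampleCov X).PosDef) :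
    0 < profileLikelihood X 0 := by
  have : (2 : ℝ) ≤ n := by exact_mod_cast hn
  have hA := (hX.smul (div_pos (by linarith : 0 < (n : ℝ) - 1)
    (by linarith : 0 < (n : ℝ)))).det_pos
  rw [profileLikelihood, zero_div, add_zero, mul_one]
  positivity

/-- For fixed `θ` the best dispersion is `dispersionMLE X θ`, and the resulting profile decreases in
the distance from `√n X̄` to `√n θ`. As `K` is a cone, `√n θ` ranges over `K` itself, so the nearest
point is optimal. -/
lemma supLikelihood_eq (hn : 2 ≤ n) {K : Set (EuclideanSpace ℝ (Fin p))} (hK : IsClosedCone K)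
    {X : Sample n p} (hX : (sampleCov X).PosDef) :
    supLikelihood K X = ENNReal.ofReal (profileLikelihood X (meanDistSq K X)) := by
  have hn2 : (2 : ℝ) ≤ n := by exact_mod_cast hn
  have hsn : 0 < Real.sqrt n := Real.sqrt_pos.2 (by linarith)
  refine le_antisymm (iSup₂_le fun θ hθ => iSup₂_le fun V hV => ENNReal.ofReal_le_ofReal ?_) ?_
  · refine (likelihood_le (by omega) (posDef_dispersionMLE hn hX θ) hV).trans ?_
    rw [likelihood_dispersionMLE hn hX, profileLikelihood_eq hn hX,
      profileLikelihood_eq hn hX (meanDistSq K X)]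
    have h := meanDistSq_le (by omega) X (hK.smul_mem _ hsn.le θ hθ)
    have h0 := meanDistSq_nonneg (by omega) K X
    have hc := profileLikelihood_zero_pos hn hX
    have hn1 : 0 < (n : ℝ) - 1 := by linarith
    gcongr
  · obtain ⟨z, hz, -, hzd⟩ := exists_sqNorm_eq_meanDistSq hK.isClosed ⟨0, hK.zero_mem⟩ hX
    have hθ := hK.smul_mem _ (inv_nonneg.2 hsn.le) z hz
    refine le_iSup₂_of_le _ hθ
      (le_iSup₂_of_le _ (posDef_dispersionMLE hn hX ((Real.sqrt n)⁻¹ • z)) ?_)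
    rw [likelihood_dispersionMLE hn hX, smul_smul, mul_inv_cancel₀ hsn.ne', one_smul, ← hzd]

lemma likelihoodRatio_eq (hn : 2 ≤ n) {K : Set (EuclideanSpace ℝ (Fin p))} (hK : IsClosedCone K)
    {X : Sample n p} (hX : (sampleCov X).PosDef) :
    likelihoodRatio K X = ENNReal.ofReal (Real.sqrt
      (((n - 1) + meanLengthSq X) / ((n - 1) + meanDistSq K X)) ^ n) := by
  have hn2 : (2 : ℝ) ≤ n := by exact_mod_cast hn
  have hn1 : 0 < (n : ℝ) - 1 := by linarith
  -- The null hypothesis is itself a closed cone, so the same formula evaluates the denominator.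
  have hzero : IsClosedCone ({0} : Set (EuclideanSpace ℝ (Fin p))) :=
    ⟨isClosed_singleton, rfl, fun c _ z hz => by rw [Set.mem_singleton_iff.1 hz]; simp⟩
  have ht : meanDistSq {0} X = meanLengthSq X := by
    simp [meanDistSq, meanLengthSq]
  have hr0 := meanDistSq_nonneg (by omega) K X
  have ht0 := hr0.trans (meanDistSq_le_meanLengthSq (by omega) hK.zero_mem X)
  have hc := profileLikelihood_zero_pos hn hX
  set t := meanLengthSq X
  set r := meanDistSq K X
  have hst : 0 < Real.sqrt (1 + t / (n - 1)) := Real.sqrt_pos.2 (by positivity)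
  have hsr : 0 < Real.sqrt (1 + r / (n - 1)) := Real.sqrt_pos.2 (by positivity)
  rw [likelihoodRatio, supLikelihood_eq hn hK hX, supLikelihood_eq hn hzero hX, ht,
    profileLikelihood_eq hn hX, profileLikelihood_eq hn hX t,
    ← ENNReal.ofReal_div_of_pos (by positivity)]
  congr 1
  rw [mul_div_mul_left _ _ hc.ne', ← div_pow, inv_div_inv, ← Real.sqrt_div' _ (by positivity)]
  congr 2
  field_simp
  change ((n : ℝ) - 1 + r) / (n - 1 + r) = 1
  exact div_self (by positivity)

lemma critRegion_likelihoodRatio_ae_eq (hp : 1 ≤ p) (hnp : p < n) (c : ℝ≥0∞) :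
    (∀ K, IsClosedCone K →
      critRegion (likelihoodRatio K) c =ᵐ[volume] (Set.univ : Set (Sample n p))) ∨
    (∀ K, IsClosedCone K →
      critRegion (likelihoodRatio K) c =ᵐ[volume] (∅ : Set (Sample n p))) ∨
    ∃ a : ℝ, 0 < a ∧ ∀ K, IsClosedCone K →
      critRegion (likelihoodRatio K) c =ᵐ[volume] (meanRegion (n - 1) a K : Set (Sample n p)) := by
  have hn : 2 ≤ n := by omega
  have hn2 : (2 : ℝ) ≤ n := by exact_mod_cast hn
  have hn1 : 0 < (n : ℝ) - 1 := by linarith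
  rcases le_or_gt c 1 with hc | hc
  · refine Or.inl fun K hK => Filter.eventuallyEq_set.2 ?_
    filter_upwards [ae_posDef_sampleCov hnp] with X hX
    refine iff_of_true ?_ (Set.mem_univ X)
    change c ≤ likelihoodRatio K X
    refine hc.trans ?_
    rw [likelihoodRatio_eq hn hK hX, ENNReal.one_le_ofReal]
    have h1 := meanDistSq_nonneg (by omega) K X
    have h2 := meanDistSq_le_meanLengthSq (by omega) hK.zero_mem X
    refine one_le_pow₀ (Real.one_le_sqrt.2 ?_)
    rw [one_le_div (by linarith)]
    linarith
  rcases eq_or_ne c ⊤ with rfl | hctop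
  · refine Or.inr (Or.inl fun K hK => Filter.eventuallyEq_set.2 ?_)
    filter_upwards [ae_posDef_sampleCov hnp] with X hX
    refine iff_of_false ?_ (Set.notMem_empty X)
    change ¬ ⊤ ≤ likelihoodRatio K X
    rw [likelihoodRatio_eq hn hK hX, top_le_iff]
    exact ENNReal.ofReal_ne_top
  · have hc1 : 1 < c.toReal := by
      rw [← ENNReal.toReal_one]
      exact (ENNReal.toReal_lt_toReal ENNReal.one_ne_top hctop).2 hc
    -- The ratio reaches `c` exactly when `(n - 1 + t) / (n - 1 + d) ≥ c ^ (2 / n) = e ^ 2`;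
    -- subtracting `1` gives the threshold `a = e ^ 2 - 1` with `k = n - 1`.
    set e := c.toReal ^ ((n : ℝ)⁻¹) with he
    have hen : e ^ n = c.toReal := Real.rpow_inv_natCast_pow (by linarith) (by omega)
    have he1 : 1 < e := Real.one_lt_rpow hc1 (by positivity)
    refine Or.inr (Or.inr ⟨e ^ 2 - 1, by nlinarith, fun K hK => Filter.eventuallyEq_set.2 ?_⟩)
    filter_upwards [ae_posDef_sampleCov hnp] with X hX
    change c ≤ likelihoodRatio K X ↔
      (1 + (e ^ 2 - 1)) * meanDistSq K X + (e ^ 2 - 1) * (n - 1) ≤ meanLengthSq X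
    have h1 := meanDistSq_nonneg (by omega) K X
    rw [likelihoodRatio_eq hn hK hX, ENNReal.le_ofReal_iff_toReal_le hctop (by positivity), ← hen,
      pow_le_pow_iff_left₀ (by linarith) (Real.sqrt_nonneg _) (by omega),
      Real.le_sqrt' (by linarith), le_div_iff₀ (by linarith)]
    constructor <;> intro h <;> linarith

end LikelihoodRatio

theorem proposition3p2 (n p : ℕ) [NeZero p] (hnp : p < n)
    (C : ProperCone ℝ (EuclideanSpace ℝ (Fin p)))
    (hint : (interior (C : Set (EuclideanSpace ℝ (Fin p)))).Nonempty)
    (hsub : (C : Set (EuclideanSpace ℝ (Fin p))) ⊆ lastHalfspace p) :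
    TestDominated (likelihoodRatio (n := n)) (C : Set (EuclideanSpace ℝ (Fin p)))
      (lastHalfspace p) ∧
    TestDominated (projStat (n := n)) (C : Set (EuclideanSpace ℝ (Fin p)))
      (lastHalfspace p) := by
  have hC : IsClosedCone (C : Set (EuclideanSpace ℝ (Fin p))) :=
    ⟨C.isClosed, C.zero_mem, fun c hc z hz => C.smul_mem hz hc⟩
  have hp : 1 ≤ p := Nat.one_le_iff_ne_zero.2 (NeZero.ne p)
  have hn1 : 0 < (n : ℝ) - 1 := by
    have : (2 : ℝ) ≤ n := by exact_mod_cast (by omega : 2 ≤ n)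
    linarith
  exact ⟨testDominated_of_critRegion_ae_eq hnp hn1 hC hint hsub
      (critRegion_likelihoodRatio_ae_eq hp hnp),
    testDominated_of_critRegion_ae_eq hnp one_pos hC hint hsub (critRegion_projStat_ae_eq hnp)⟩
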